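/- Let $d\in\mathbb N$, $\gamma\le 0$, and set, for $z\in\mathbb R^d$, $$A(z)=|z|^\gamma\,(|z|^2 I_d-z\otimes z),\qquad b(z)=\nabla\cdot A(z)=-(d-1)\,|z|^\gamma z$$ (so $b(z)=-2z|z|^\gamma$ when $d=3$). Write $\langle v\rangle=(1+|v|^2)^{1/2}$, $|x|_M^2=x\cdot Mx$, $\|M\|$ for the operator norm of a matrix $M$, $(A*h)(v)=\int A(v-w)h(w)\,dw$, $(b*h)(v)=\int b(v-w)h(w)\,dw$, $$U[f](v)=-\int_{\mathbb R^d}A(v-w)\big(\nabla\log f(v)-\nabla\log f(w)\big)f(w)\,dw,\qquad \mathrm{KL}(f\|g)=\int_{\mathbb R^d} f\log\frac fg\,dv.$$ Let $f,g$ be differentiable probability densities on $\mathbb R^d$ with finite energy $\frac12\int|v|^2f\,dv$ and finite entropy $\int f\log f\,dv$ (and likewise for $g$). They may vanish: integrands carrying a factor $f$ are read as $0$ where $f=0$, also inside $U[f]$, and likewise for $g$; but $g>0$ is required almost everywhere on $\{f>0\}$. No equation is assumed for $f$ or $g$. (1) There is a constant $C>0$, depending only on $d$, $\gamma$ and on upper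 bounds for the energy and the entropy of $g$, such that $$\int f\,(U[f]-U[g])\cdot\nabla\log\frac fg\;\le\;-\frac12\int f\,\Big|\nabla\log\frac fg\Big|^2_{A*g}+C\int f\langle v\rangle^{-\gamma}\|A*(f-g)\|^2|\nabla\log f|^2+C\int f\langle v\rangle^{-\gamma}|b*(f-g)|^2$$ whenever both sides are defined and finite, i.e. the integrals defining $U[f](v)$, $U[g](v)$, $(A*g)(v)$, $(A*(f-g))(v)$, $(b*(f-g))(v)$ converge absolutely for almost every $v$ with $f(v)>0$, and the four displayed integrals converge absolutely. (2) Let $d=3$, $\gamma=-3$. There is a constant $C>0$, depending only on upper bounds for the energy and the entropy of $g$, such that $$\int f\,(U[f]-U[g])\cdot\nabla\log\frac fg\;\le\;-\frac12\int f\,\Big|\nabla\log\frac fg\Big|^2_{A*g}+C\,\mathrm{KL}(f\|g)\Big(\big(\|f\|_\infty+\|g\|_\infty\big)\big(\|f\langle v\rangle^3|\nabla\log f|^2\|_1+\|f\langle v\rangle^3\|_2\big)+\|f\langle v\rangle^3\|_1\Big)$$ whenever both sides are defined and finite, i.e. the integrals defining $U[f](v)$ and $U[g](v)$ converge absolutely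 for almost every $v$ with $f(v)>0$, the two displayed integrals and the integral defining $\mathrm{KL}(f\|g)$ converge absolutely, and all the norms on the right are finite. -/

import Mathlib

open MeasureTheory
open scoped Convolution ENNReal

noncomputable section

namespace Landau

/-- Velocity space `ℝ^d` with its Euclidean norm. -/
abbrev Vel (d : ℕ) : Type := EuclideanSpace ℝ (Fin d)

variable {d : ℕ}

/-- The Landau kernel `A(z) = |z|^γ (|z|² I_d - z ⊗ z)`, as an operator on `ℝ^d`
(so that `‖·‖` is the operator norm of the matrix). -/
def A (γ : ℝ) (z : Vel d) : Vel d →L[ℝ] Vel d :=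
  (‖z‖ ^ γ) • ((‖z‖ ^ 2) • ContinuousLinearMap.id ℝ (Vel d) - (innerSL ℝ z).smulRight z)

/-- The divergence `b = ∇ · A`, that is `b(z) = -(d - 1) |z|^γ z`; this is `-2 z |z|^γ` for `d = 3`.
See `divergence_A`. -/
def b (γ : ℝ) (z : Vel d) : Vel d :=
  (-((d : ℝ) - 1) * ‖z‖ ^ γ) • z

/-- The Japanese bracket `⟨v⟩ = (1 + |v|²)^{1/2}`. -/
def jb (v : Vel d) : ℝ := Real.sqrt (1 + ‖v‖ ^ 2)

/-- `∇ log f`. -/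
def score (f : Vel d → ℝ) (v : Vel d) : Vel d :=
  gradient (fun w => Real.log (f w)) v

/-- `∇ log (f / g)`. -/
def relScore (f g : Vel d → ℝ) (v : Vel d) : Vel d :=
  gradient (fun w => Real.log (f w / g w)) v

/-- The integrand (in `w`) of the velocity field `U[f](v)`. -/
def fieldIntegrand (γ : ℝ) (f : Vel d → ℝ) (v w : Vel d) : Vel d :=
  f w • A γ (v - w) (score f v - score f w)

/-- The velocity field
`U[f](v) = - ∫ A(v - w) (∇ log f(v) - ∇ log f(w)) f(w) dw`. -/
def U (γ : ℝ) (f : Vel d → ℝ) (v : Vel d) : Vel d :=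
  -∫ w, fieldIntegrand γ f v w

/-- The convolution `(A ∗ h)(v) = ∫ h(w) A(v - w) dw`. -/
def convA (γ : ℝ) (h : Vel d → ℝ) : Vel d → (Vel d →L[ℝ] Vel d) :=
  h ⋆[ContinuousLinearMap.lsmul ℝ ℝ, volume] A γ

/-- The integral defining `(A ∗ h)(v)` converges absolutely. -/
def ConvAExistsAt (γ : ℝ) (h : Vel d → ℝ) (v : Vel d) : Prop :=
  ConvolutionExistsAt h (A γ) v (ContinuousLinearMap.lsmul ℝ ℝ) volume

/-- The convolution `(b ∗ h)(v) = ∫ h(w) b(v - w) dw`. -/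
def convB (γ : ℝ) (h : Vel d → ℝ) : Vel d → Vel d :=
  h ⋆[ContinuousLinearMap.lsmul ℝ ℝ, volume] b γ

/-- The integral defining `(b ∗ h)(v)` converges absolutely. -/
def ConvBExistsAt (γ : ℝ) (h : Vel d → ℝ) (v : Vel d) : Prop :=
  ConvolutionExistsAt h (b γ) v (ContinuousLinearMap.lsmul ℝ ℝ) volume

/-- `|x|²_M = x · M x`. -/
def quadNormSq (M : Vel d →L[ℝ] Vel d) (x : Vel d) : ℝ := inner ℝ x (M x)

/-- The energy `½ ∫ |v|² f dv`. -/
def energy (f : Vel d → ℝ) : ℝ := 1 / 2 * ∫ v, ‖v‖ ^ 2 * f v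

/-- The entropy `∫ f log f dv`. -/
def entropy (f : Vel d → ℝ) : ℝ := ∫ v, f v * Real.log (f v)

/-- `KL(f ‖ g) = ∫ f log (f / g) dv`. -/
def KL (f g : Vel d → ℝ) : ℝ := ∫ v, f v * Real.log (f v / g v)

/-- `f` is a differentiable probability density on `ℝ^d` with finite energy and entropy. -/
structure IsDensity (f : Vel d → ℝ) : Prop where
  nonneg : ∀ v, 0 ≤ f v
  differentiable : Differentiable ℝ f
  integrable : Integrable f
  integral_eq_one : ∫ v, f v = 1
  finite_energy : Integrable fun v => ‖v‖ ^ 2 * f v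
  finite_entropy : Integrable fun v => f v * Real.log (f v)

/-- The integrand `f (U[f] - U[g]) · ∇ log (f / g)`. -/
def lhsIntegrand (γ : ℝ) (f g : Vel d → ℝ) (v : Vel d) : ℝ :=
  f v * inner ℝ (U γ f v - U γ g v) (relScore f g v)

/-- The integrand `f |∇ log (f / g)|²_{A ∗ g}`. -/
def dissipationIntegrand (γ : ℝ) (f g : Vel d → ℝ) (v : Vel d) : ℝ :=
  f v * quadNormSq (convA γ g v) (relScore f g v)

/-- The integrand `f ⟨v⟩^{-γ} ‖A ∗ (f - g)‖² |∇ log f|²`. -/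
def diffusionErrorIntegrand (γ : ℝ) (f g : Vel d → ℝ) (v : Vel d) : ℝ :=
  f v * jb v ^ (-γ) * ‖convA γ (f - g) v‖ ^ 2 * ‖score f v‖ ^ 2

/-- The integrand `f ⟨v⟩^{-γ} |b ∗ (f - g)|²`. -/
def driftErrorIntegrand (γ : ℝ) (f g : Vel d → ℝ) (v : Vel d) : ℝ :=
  f v * jb v ^ (-γ) * ‖convB γ (f - g) v‖ ^ 2

/-- The left-hand side `∫ f (U[f] - U[g]) · ∇ log (f / g)` is defined and finite: for almost every
`v` with `f(v) > 0` one has `g(v) > 0` and the integrals defining `U[f](v)` and `U[g](v)` converge,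
and the outer integral converges. -/
structure LhsFinite (γ : ℝ) (f g : Vel d → ℝ) : Prop where
  pos : ∀ᵐ v, 0 < f v → 0 < g v
  field_left : ∀ᵐ v, 0 < f v → Integrable (fieldIntegrand γ f v)
  field_right : ∀ᵐ v, 0 < f v → Integrable (fieldIntegrand γ g v)
  integrable : Integrable (lhsIntegrand γ f g)

/-- The right-hand side of the general inequality is defined and finite. -/
structure RhsFinite (γ : ℝ) (f g : Vel d → ℝ) : Prop where
  convA_right : ∀ᵐ v, 0 < f v → ConvAExistsAt γ g v
  convA_sub : ∀ᵐ v, 0 < f v → ConvAExistsAt γ (f - g) v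
  convB_sub : ∀ᵐ v, 0 < f v → ConvBExistsAt γ (f - g) v
  dissipation : Integrable (dissipationIntegrand γ f g)
  diffusionError : Integrable (diffusionErrorIntegrand γ f g)
  driftError : Integrable (driftErrorIntegrand γ f g)

/-- The right-hand side of the Coulomb inequality (`d = 3`, `γ = -3`) is defined and finite. -/
structure CoulombRhsFinite (f g : Vel 3 → ℝ) : Prop where
  dissipation : Integrable (dissipationIntegrand (-3) f g)
  kl : Integrable fun v => f v * Real.log (f v / g v)
  sup_left : MemLp f ∞
  sup_right : MemLp g ∞
  fisher : MemLp (fun v => f v * jb v ^ 3 * ‖score f v‖ ^ 2) 1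
  weighted_two : MemLp (fun v => f v * jb v ^ 3) 2
  weighted_one : MemLp (fun v => f v * jb v ^ 3) 1

/-- `(‖f‖_∞ + ‖g‖_∞) (‖f ⟨v⟩³ |∇ log f|²‖_1 + ‖f ⟨v⟩³‖_2) + ‖f ⟨v⟩³‖_1`. -/
def coulombFactor (f g : Vel 3 → ℝ) : ℝ :=
  (lpNorm f ∞ volume + lpNorm g ∞ volume) *
      (lpNorm (fun v => f v * jb v ^ 3 * ‖score f v‖ ^ 2) 1 volume +
        lpNorm (fun v => f v * jb v ^ 3) 2 volume) +
    lpNorm (fun v => f v * jb v ^ 3) 1 volume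

/-- Away from the origin `b` is the divergence of `A`. -/
theorem divergence_A (γ : ℝ) {z : Vel d} (hz : z ≠ 0) :
    DifferentiableAt ℝ (A (d := d) γ) z ∧
      ∑ i, fderiv ℝ (A γ) z (EuclideanSpace.single i 1) (EuclideanSpace.single i 1) = b γ z := by
  have hn : HasFDerivAt (fun x : Vel d => ‖x‖ ^ 2) (2 • innerSL ℝ z) z :=
    (hasStrictFDerivAt_norm_sq z).hasFDerivAt
  have hz2 : ‖z‖ ^ 2 ≠ 0 := by simpa using hz
  have hp := hn.rpow_const (p := γ / 2) (Or.inl hz2)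
  have he : ∀ x : Vel d, (‖x‖ ^ 2) ^ (γ / 2) = ‖x‖ ^ γ := fun x => by
    rw [← Real.rpow_natCast, ← Real.rpow_mul (norm_nonneg x)]
    congr 1
    push_cast
    ring
  simp only [he] at hp
  have hr : HasFDerivAt (fun x : Vel d => (innerSL ℝ x).smulRight x) _ z :=
    (ContinuousLinearMap.smulRightL ℝ (Vel d) (Vel d)).hasFDerivAt_of_bilinear
      (innerSL ℝ (E := Vel d)).hasFDerivAt (hasFDerivAt_id z)
  have hA := hp.smul ((hn.smul_const (ContinuousLinearMap.id ℝ (Vel d))).sub hr)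
  have hA' : HasFDerivAt (A (d := d) γ) _ z := hA
  refine ⟨hA'.differentiableAt, ?_⟩
  rw [hA'.fderiv]
  have hi : ∀ x : Fin d, inner ℝ z (EuclideanSpace.single x (1 : ℝ)) = z x := fun x => by
    simp [EuclideanSpace.inner_single_right]
  have h1 : ∀ x : Fin d, (innerSL ℝ (EuclideanSpace.single x (1 : ℝ)))
      (EuclideanSpace.single x (1 : ℝ)) = 1 := fun x => by
    rw [innerSL_apply_apply, EuclideanSpace.inner_single_right]; simp
  have hsq : ∑ x, z x * z x = ‖z‖ ^ 2 := by
    rw [EuclideanSpace.real_norm_sq_eq]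
    exact Finset.sum_congr rfl fun x _ => (sq _).symm
  have hδ : ∀ j : Fin d, ∑ x, z x * (Pi.single x (1 : ℝ) : Fin d → ℝ) j = z j := fun j => by
    simp [Pi.single_apply]
  ext j
  simp only [b, Finset.sum_add_distrib, add_apply, sub_apply, smul_apply,
    ContinuousLinearMap.smulRight_apply, PiLp.add_apply, PiLp.smul_apply, PiLp.sub_apply,
    WithLp.ofLp_sum, Finset.sum_apply]
  simp [hi, h1]
  have e1 : ∑ x, ‖z‖ ^ γ * (2 * z x * (Pi.single x (1 : ℝ) : Fin d → ℝ) j -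
      (z x * (Pi.single x (1 : ℝ) : Fin d → ℝ) j + z j)) =
      ‖z‖ ^ γ * (∑ x, z x * (Pi.single x (1 : ℝ) : Fin d → ℝ) j - d * z j) := by
    rw [← Finset.mul_sum]
    congr 1
    rw [eq_sub_iff_add_eq, show (d : ℝ) * z j = ∑ _x : Fin d, z j by simp,
      ← Finset.sum_add_distrib]
    exact Finset.sum_congr rfl fun x _ => by ring
  have e2 : ∑ x, γ / 2 * (‖z‖ ^ 2) ^ (γ / 2 - 1) * (2 * z x) *
      (‖z‖ ^ 2 * (Pi.single x (1 : ℝ) : Fin d → ℝ) j - z x * z j) =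
      γ * (‖z‖ ^ 2) ^ (γ / 2 - 1) *
        (‖z‖ ^ 2 * ∑ x, z x * (Pi.single x (1 : ℝ) : Fin d → ℝ) j -
          (∑ x, z x * z x) * z j) := by
    rw [Finset.mul_sum, Finset.sum_mul, ← Finset.sum_sub_distrib, Finset.mul_sum]
    exact Finset.sum_congr rfl fun x _ => by ring
  rw [hδ] at e1 e2
  simp only [Pi.single_apply, mul_ite, mul_one, mul_zero] at e1 e2
  rw [e1, e2, hsq]
  ring

end Landau

end

/-!
Integrating by parts, `∫ A(v - w) ∇h(w) dw = (b ∗ h)(v)`. Hence `U[f] = -(A ∗ f) ∇ log f + b ∗ f`,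
and with `h = f - g`
`U[f] - U[g] = -(A ∗ g) ∇ log (f / g) - (A ∗ h) ∇ log f + b ∗ h`.
Pairing the first term with `f ∇ log (f / g)` gives the dissipation. A density with bounded energy
and entropy cannot concentrate near a hyperplane, so `A ∗ g ≥ c ⟨v⟩^γ`, and Young's inequality
absorbs the pairings with the two other terms into half of the dissipation.

In the Coulomb case the singular parts of `A` and `b` are at most `k²` and `2 k³` for the truncated
power `k = |z|^{-2/3} 1_{|z| < 1}`, which lies in `L⁴(ℝ³)`. By Cauchy–Schwarz the two errors are
then controlled by `‖f - g‖₁²` and `‖f - g‖₂²`. Both are controlled by the relative entropy, through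
`∫ (f - g)² / (f + g) ≤ 2 KL(f ‖ g)`; since `g` has mass at least `1/2` in a fixed ball, `‖g‖_∞` is
bounded below, which makes up for the missing factor `‖f‖_∞ + ‖g‖_∞` in the bound of `‖f - g‖₁²`.
-/

namespace Landau

section Divergence

variable {V : Type*} [NormedAddCommGroup V] [NormedSpace ℝ V]

/-- The divergence `∇ · X` of a vector field, as the trace of its derivative, which needs no choice
of coordinates. -/
noncomputable def divergence (X : V → V) (x : V) : ℝ :=
  LinearMap.trace ℝ V (fderiv ℝ X x)

theorem divergence_smul [FiniteDimensional ℝ V] {c : V → ℝ} {X : V → V} {x : V}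
    (hc : DifferentiableAt ℝ c x) (hX : DifferentiableAt ℝ X x) :
    divergence (fun y => c y • X y) x = c x * divergence X x + fderiv ℝ c x (X x) := by
  rw [divergence, fderiv_fun_smul hc hX, ContinuousLinearMap.toLinearMap_add, map_add,
    ContinuousLinearMap.toLinearMap_smul, map_smul, smul_eq_mul, divergence]
  congr 1
  exact LinearMap.trace_smulRight _ _

theorem divergence_sub {X Y : V → V} {x : V} (hX : DifferentiableAt ℝ X x)
    (hY : DifferentiableAt ℝ Y x) :
    divergence (fun y => X y - Y y) x = divergence X x - divergence Y x := by
  rw [divergence, fderiv_fun_sub hX hY, ContinuousLinearMap.toLinearMap_sub, map_sub, divergence,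
    divergence]

theorem measurable_divergence [FiniteDimensional ℝ V] [MeasurableSpace V] [BorelSpace V]
    (X : V → V) : Measurable (divergence X) :=
  (LinearMap.continuous_of_finiteDimensional
    (LinearMap.trace ℝ V ∘ₗ ContinuousLinearMap.coeLM ℝ)).measurable.comp (measurable_fderiv ℝ X)

theorem divergence_conj {W : Type*} [NormedAddCommGroup W] [NormedSpace ℝ W]
    (e : V ≃L[ℝ] W) {X : V → V} (hX : Differentiable ℝ X) (y : W) :
    divergence (fun y => e (X (e.symm y))) y = divergence X (e.symm y) := by
  have hderiv : HasFDerivAt (fun y => e (X (e.symm y)))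
      ((e : V →L[ℝ] W) ∘L fderiv ℝ X (e.symm y) ∘L (e.symm : W →L[ℝ] V)) y :=
    e.hasFDerivAt.comp y ((hX _).hasFDerivAt.comp y e.symm.hasFDerivAt)
  rw [divergence, hderiv.fderiv]
  exact LinearMap.trace_conj' (fderiv ℝ X (e.symm y)).toLinearMap e.toLinearEquiv

theorem divergence_eq_sum {n : ℕ} (X : (Fin n → ℝ) → Fin n → ℝ) (x : Fin n → ℝ) :
    divergence X x = ∑ i, fderiv ℝ X x (Pi.single i 1) i := by
  simp [divergence, LinearMap.trace_eq_matrix_trace ℝ (Pi.basisFun ℝ (Fin n)), Matrix.trace]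

theorem integral_divergence_pi_eq_zero {n : ℕ} {X : (Fin n → ℝ) → Fin n → ℝ}
    (hX : Differentiable ℝ X) (hsupp : HasCompactSupport X) (hint : Integrable (divergence X)) :
    ∫ x, divergence X x = 0 := by
  cases n with
  | zero => simp [divergence_eq_sum]
  | succ n =>
    obtain ⟨R, hR, hsub⟩ := hsupp.isCompact.isBounded.subset_ball_lt 0 0
    have outside : ∀ {x : Fin (n + 1) → ℝ} {i}, R ≤ |x i| → x ∉ tsupport X := fun {x i} hx hmem =>
      (mem_ball_zero_iff.1 (hsub hmem)).not_ge (hx.trans (norm_le_pi_norm x i))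
    have hbox := integral_divergence_of_hasFDerivAt_off_countable (fun _ => -R) (fun _ => R)
      (fun _ => by simpa using hR.le) X (fderiv ℝ X) ∅ Set.countable_empty
      (fun x _ => (hX x).continuousAt.continuousWithinAt) (fun x _ => (hX x).hasFDerivAt)
      (by simpa only [← divergence_eq_sum] using hint.integrableOn)
    have hface : ∀ {x : Fin (n + 1) → ℝ} {i}, |x i| = R → X x i = 0 := fun hx => by
      rw [image_eq_zero_of_notMem_tsupport (outside hx.ge), Pi.zero_apply]
    have hoff : ∀ x ∉ Set.Icc (fun _ => -R) (fun _ : Fin (n + 1) => R), divergence X x = 0 := by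
      intro x hx
      obtain ⟨i, hi⟩ : ∃ i, R < |x i| := by
        by_contra! h
        exact hx ⟨fun i => (abs_le.1 (h i)).1, fun i => (abs_le.1 (h i)).2⟩
      have hfderiv : fderiv ℝ X x = 0 := image_eq_zero_of_notMem_tsupport fun h =>
        outside hi.le (tsupport_fderiv_subset ℝ h)
      simp [divergence, hfderiv]
    rw [← setIntegral_eq_integral_of_forall_compl_eq_zero hoff]
    simp only [divergence_eq_sum]
    rw [hbox]
    refine Finset.sum_eq_zero fun i _ => ?_
    simp [hface, abs_of_pos hR]

-- Since `X` is merely differentiable, its partial derivatives need not be integrable and Fubini is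
-- not available; the underlying divergence theorem on boxes uses the Henstock–Kurzweil integral.
theorem integral_divergence_eq_zero [FiniteDimensional ℝ V] [MeasurableSpace V] [BorelSpace V]
    {μ : Measure V} [μ.IsAddHaarMeasure] {X : V → V} (hX : Differentiable ℝ X)
    (hsupp : HasCompactSupport X) (hint : Integrable (divergence X) μ) :
    ∫ x, divergence X x ∂μ = 0 := by
  let e : V ≃L[ℝ] (Fin (Module.finrank ℝ V) → ℝ) := ContinuousLinearEquiv.ofFinrankEq (by simp)
  have he : MeasurableEmbedding e := e.toHomeomorph.measurableEmbedding
  have hvol : volume = Measure.addHaarScalarFactor volume (μ.map e) • μ.map e :=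
    Measure.isAddLeftInvariant_eq_smul _ _
  have hconj : divergence (fun y => e (X (e.symm y))) = fun y => divergence X (e.symm y) :=
    funext (divergence_conj e hX)
  have hzero : ∫ y, divergence (fun y => e (X (e.symm y))) y = 0 := by
    refine integral_divergence_pi_eq_zero (by fun_prop) ?_ ?_
    · exact (hsupp.comp_homeomorph e.symm.toHomeomorph).comp_left (map_zero e)
    · rw [hconj, hvol]
      refine Integrable.smul_measure_nnreal ?_
      simpa [he.integrable_map_iff, Function.comp_def] using hint
  rw [hconj, hvol, integral_smul_nnreal_measure, he.integral_map] at hzero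
  simpa [NNReal.smul_def,
    (Measure.addHaarScalarFactor_pos_of_isAddHaarMeasure volume (μ.map e)).ne'] using hzero

end Divergence

section InnerProductSpace

variable {V : Type*} [NormedAddCommGroup V] [InnerProductSpace ℝ V]

theorem inner_gradient_eq_fderiv [CompleteSpace V] (h : V → ℝ) (w y : V) :
    inner ℝ (gradient h w) y = fderiv ℝ h w y := by
  simp [gradient]

theorem hasFDerivAt_normSq_const_sub (v w : V) :
    HasFDerivAt (fun w : V => ‖v - w‖ ^ 2) (-(2 • innerSL ℝ (v - w))) w := by
  simpa only [id_eq, ContinuousLinearMap.comp_neg, ContinuousLinearMap.comp_id, smul_neg] using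
    ((hasFDerivAt_id w).const_sub v).norm_sq

theorem hasFDerivAt_inner_const_sub (v e w : V) :
    HasFDerivAt (fun w : V => inner ℝ (v - w) e) (-innerSL ℝ e) w := by
  simpa only [inner_sub_left, innerSL_apply_apply, real_inner_comm] using
    ((innerSL ℝ e).hasFDerivAt (x := w)).const_sub (inner ℝ e v)

theorem differentiable_normSq_smul_sub_inner_smul (v e : V) :
    Differentiable ℝ fun w => ‖v - w‖ ^ 2 • e - inner ℝ (v - w) e • (v - w) := fun w =>
  ((hasFDerivAt_normSq_const_sub v w).differentiableAt.smul_const e).fun_sub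
    ((hasFDerivAt_inner_const_sub v e w).differentiableAt.fun_smul (by fun_prop))

variable [FiniteDimensional ℝ V]

theorem divergence_const_sub_id (v w : V) :
    divergence (fun w => v - w) w = -Module.finrank ℝ V := by
  rw [divergence, fderiv_const_sub, fderiv_fun_id, ContinuousLinearMap.toLinearMap_neg, map_neg,
    ContinuousLinearMap.coe_id, LinearMap.trace_id]

theorem divergence_normSq_smul_sub_inner_smul (v e w : V) :
    divergence (fun w => ‖v - w‖ ^ 2 • e - inner ℝ (v - w) e • (v - w)) w =
      (Module.finrank ℝ V - 1) * inner ℝ (v - w) e := by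
  have hnorm := hasFDerivAt_normSq_const_sub v w
  have hinner := hasFDerivAt_inner_const_sub v e w
  have hfirst : divergence (fun w : V => ‖v - w‖ ^ 2 • e) w = -2 * inner ℝ (v - w) e := by
    rw [divergence_smul hnorm.differentiableAt (differentiableAt_const e), hnorm.fderiv]
    simp [divergence, inner_sub_left]
  have hsecond : divergence (fun w : V => inner ℝ (v - w) e • (v - w)) w =
      -(Module.finrank ℝ V + 1) * inner ℝ (v - w) e := by
    rw [divergence_smul hinner.differentiableAt (by fun_prop), hinner.fderiv,
      divergence_const_sub_id, neg_apply, innerSL_apply_apply, real_inner_comm]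
    ring
  rw [divergence_sub (hnorm.differentiableAt.smul_const e)
    (hinner.differentiableAt.fun_smul (by fun_prop)), hfirst, hsecond]
  ring

-- The derivative of `ψ` drops out because `|z|² e - ⟨z, e⟩ z` is orthogonal to `z`.
theorem divergence_radial_smul {ψ : ℝ → ℝ} (hψ : Differentiable ℝ ψ) {h : V → ℝ}
    (hh : Differentiable ℝ h) (v e w : V) :
    divergence (fun w => (ψ (‖v - w‖ ^ 2) * h w) •
        (‖v - w‖ ^ 2 • e - inner ℝ (v - w) e • (v - w))) w =
      ψ (‖v - w‖ ^ 2) *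
        (inner ℝ (gradient h w) (‖v - w‖ ^ 2 • e - inner ℝ (v - w) e • (v - w)) +
          h w * ((Module.finrank ℝ V - 1) * inner ℝ (v - w) e)) := by
  have hcoeff : HasFDerivAt (fun w => ψ (‖v - w‖ ^ 2) * h w) _ w :=
    ((hψ _).hasDerivAt.comp_hasFDerivAt w (hasFDerivAt_normSq_const_sub v w)).mul (hh w).hasFDerivAt
  have horth : inner ℝ (v - w) (‖v - w‖ ^ 2 • e - inner ℝ (v - w) e • (v - w)) = 0 := by
    rw [inner_sub_right, real_inner_smul_right, real_inner_smul_right, real_inner_self_eq_norm_sq]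
    ring
  rw [divergence_smul hcoeff.differentiableAt (differentiable_normSq_smul_sub_inner_smul v e w),
    divergence_normSq_smul_sub_inner_smul, hcoeff.fderiv, inner_gradient_eq_fderiv]
  simp only [add_apply, smul_apply, neg_apply, innerSL_apply_apply, horth, Function.comp_apply,
    smul_eq_mul, smul_zero, neg_zero, mul_zero, add_zero]
  ring

end InnerProductSpace

/-- A smooth cutoff of `(0, ∞)` that is supported in `[1 / n, n]` and exhausts `(0, ∞)` as `n`
grows; it removes the singularity of the kernels at the origin and their growth at infinity. -/
noncomputable def annulusCutoff (n : ℕ) (s : ℝ) : ℝ :=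
  Real.smoothTransition (n * s - 1) * Real.smoothTransition (n - s)

theorem annulusCutoff_nonneg (n : ℕ) (s : ℝ) : 0 ≤ annulusCutoff n s :=
  mul_nonneg (Real.smoothTransition.nonneg _) (Real.smoothTransition.nonneg _)

theorem annulusCutoff_le_one (n : ℕ) (s : ℝ) : annulusCutoff n s ≤ 1 :=
  mul_le_one₀ (Real.smoothTransition.le_one _) (Real.smoothTransition.nonneg _)
    (Real.smoothTransition.le_one _)

theorem annulusCutoff_eq_zero {n : ℕ} {s : ℝ} (hs : n ≤ s) : annulusCutoff n s = 0 := by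
  rw [annulusCutoff, Real.smoothTransition.zero_of_nonpos (sub_nonpos.2 hs), mul_zero]

theorem eventually_annulusCutoff_eq_one {s : ℝ} (hs : 0 < s) :
    ∀ᶠ n : ℕ in Filter.atTop, annulusCutoff n s = 1 := by
  filter_upwards [Filter.eventually_ge_atTop ⌈2 / s⌉₊,
    Filter.eventually_ge_atTop ⌈1 + s⌉₊] with n hsmall hlarge
  have hsmall := (div_le_iff₀ hs).1 (Nat.ceil_le.1 hsmall)
  have hlarge := Nat.ceil_le.1 hlarge
  rw [annulusCutoff, Real.smoothTransition.one_of_one_le (by linarith),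
    Real.smoothTransition.one_of_one_le (by linarith), one_mul]

theorem differentiable_annulusCutoff_mul_rpow (n : ℕ) (p : ℝ) :
    Differentiable ℝ fun s => annulusCutoff n s * s ^ p := by
  have hT : Differentiable ℝ Real.smoothTransition :=
    Real.smoothTransition.contDiff.differentiable one_ne_zero
  intro s
  rcases eq_or_ne s 0 with rfl | hs
  · have hzero : (fun s => annulusCutoff n s * s ^ p) =ᶠ[nhds 0] fun _ => 0 := by
      have hlt : ∀ᶠ s : ℝ in nhds 0, n * s - 1 < 0 :=
        ContinuousAt.eventually_lt (by fun_prop) continuousAt_const (by simp)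
      filter_upwards [hlt] with s hs
      simp [annulusCutoff, Real.smoothTransition.zero_of_nonpos hs.le]
    exact hzero.differentiableAt_iff.2 (differentiableAt_const _)
  · unfold annulusCutoff
    exact DifferentiableAt.mul (by fun_prop) (Real.differentiableAt_rpow_const_of_ne p hs)

section Kernel

variable {d : ℕ}

theorem A_apply (γ : ℝ) (z x : Vel d) :
    A γ z x = ‖z‖ ^ γ • (‖z‖ ^ 2 • x - inner ℝ z x • z) := by
  simp [A]

theorem inner_A_apply_comm (γ : ℝ) (z x y : Vel d) :
    inner ℝ x (A γ z y) = inner ℝ y (A γ z x) := by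
  simp only [A_apply, inner_smul_right, inner_sub_right, real_inner_comm]
  ring

variable {γ : ℝ} {h : Vel d → ℝ}

theorem divergence_annulusCutoff_smul (n : ℕ) (γ : ℝ) (hh : Differentiable ℝ h)
    (v e w : Vel d) :
    divergence (fun w => (annulusCutoff n (‖v - w‖ ^ 2) * (‖v - w‖ ^ 2) ^ (γ / 2) * h w) •
        (‖v - w‖ ^ 2 • e - inner ℝ (v - w) e • (v - w))) w =
      annulusCutoff n (‖v - w‖ ^ 2) *
        inner ℝ e (A γ (v - w) (gradient h w) - h w • b γ (v - w)) := by
  rw [divergence_radial_smul (differentiable_annulusCutoff_mul_rpow n (γ / 2)) hh,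
    Real.rpow_div_two_eq_sqrt _ (sq_nonneg _), Real.sqrt_sq (norm_nonneg _), inner_sub_right e,
    inner_A_apply_comm, A_apply, b]
  simp only [inner_smul_right, real_inner_comm e (v - w), finrank_euclideanSpace_fin]
  ring

theorem integral_annulusCutoff_mul_eq_zero (n : ℕ) (hh : Differentiable ℝ h) (v e : Vel d)
    (hint : Integrable fun w => inner ℝ e (A γ (v - w) (gradient h w) - h w • b γ (v - w))) :
    ∫ w, annulusCutoff n (‖v - w‖ ^ 2) *
      inner ℝ e (A γ (v - w) (gradient h w) - h w • b γ (v - w)) = 0 := by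
  let X : Vel d → Vel d := fun w =>
    (annulusCutoff n (‖v - w‖ ^ 2) * (‖v - w‖ ^ 2) ^ (γ / 2) * h w) •
      (‖v - w‖ ^ 2 • e - inner ℝ (v - w) e • (v - w))
  have hX : divergence X = _ := funext (divergence_annulusCutoff_smul n γ hh v e)
  have hdiff : Differentiable ℝ X := by
    have hcut := (differentiable_annulusCutoff_mul_rpow n (γ / 2)).comp
      fun w => (hasFDerivAt_normSq_const_sub v w).differentiableAt
    exact (hcut.mul hh).smul (differentiable_normSq_smul_sub_inner_smul v e)
  have hsupp : HasCompactSupport X := by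
    refine HasCompactSupport.of_support_subset_isCompact (isCompact_closedBall v √n) fun w hw => ?_
    by_contra hfar
    rw [mem_closedBall_iff_norm', not_le, Real.sqrt_lt (Nat.cast_nonneg n) (norm_nonneg _)] at hfar
    exact hw (by simp [X, annulusCutoff_eq_zero hfar.le])
  rw [← hX]
  refine integral_divergence_eq_zero hdiff hsupp
    (hint.mono (measurable_divergence X).aestronglyMeasurable (.of_forall fun w => ?_))
  rw [hX, norm_mul, Real.norm_of_nonneg (annulusCutoff_nonneg n _)]
  exact mul_le_of_le_one_left (norm_nonneg _) (annulusCutoff_le_one n _)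

theorem integral_A_apply_gradient (hh : Differentiable ℝ h) (v : Vel d)
    (hA : Integrable fun w => A γ (v - w) (gradient h w))
    (hb : Integrable fun w => h w • b γ (v - w)) :
    ∫ w, A γ (v - w) (gradient h w) = ∫ w, h w • b γ (v - w) := by
  rcases Nat.eq_zero_or_pos d with rfl | hd
  · exact Subsingleton.elim _ _
  have : NeZero d := ⟨hd.ne'⟩
  rw [← sub_eq_zero, ← integral_sub hA hb]
  refine ext_inner_left ℝ fun e => ?_
  have hint : Integrable fun w => inner ℝ e (A γ (v - w) (gradient h w) - h w • b γ (v - w)) :=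
    (hA.sub hb).const_inner e
  rw [inner_zero_right, ← integral_inner (f := fun w => A γ (v - w) (gradient h w) -
    h w • b γ (v - w)) (hA.sub hb)]
  have hlim : Filter.Tendsto (fun n : ℕ => ∫ w, annulusCutoff n (‖v - w‖ ^ 2) *
      inner ℝ e (A γ (v - w) (gradient h w) - h w • b γ (v - w))) Filter.atTop
      (nhds (∫ w, inner ℝ e (A γ (v - w) (gradient h w) - h w • b γ (v - w)))) := by
    refine tendsto_integral_of_dominated_convergence _ (fun n => ?_) hint.norm
      (fun n => .of_forall fun w => ?_) ?_
    · rw [← funext (divergence_annulusCutoff_smul n γ hh v e)]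
      exact (measurable_divergence _).aestronglyMeasurable
    · rw [norm_mul, Real.norm_of_nonneg (annulusCutoff_nonneg n _)]
      exact mul_le_of_le_one_left (norm_nonneg _) (annulusCutoff_le_one n _)
    · filter_upwards [compl_mem_ae_iff.2 (measure_singleton v)] with w hw
      have hpos : 0 < ‖v - w‖ ^ 2 := by
        have := norm_pos_iff.2 (sub_ne_zero.2 (Ne.symm hw))
        positivity
      refine tendsto_const_nhds.congr' ?_
      filter_upwards [eventually_annulusCutoff_eq_one hpos] with n hn
      rw [hn, one_mul]
  simp only [integral_annulusCutoff_mul_eq_zero _ hh v e hint] at hlim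
  exact tendsto_nhds_unique hlim tendsto_const_nhds

end Kernel

section NonConcentration

theorem mul_sub_exp_le_mul_log {t : ℝ} (ht : 0 ≤ t) (s : ℝ) :
    t * s - Real.exp s ≤ t * Real.log t := by
  rcases ht.eq_or_lt with rfl | ht
  · simpa using (Real.exp_pos s).le
  · have hexp := Real.add_one_le_exp (s - Real.log t)
    rw [Real.exp_sub, Real.exp_log ht, le_div_iff₀ ht] at hexp
    linarith

-- Young's inequality `t s ≤ t log t + e^s` with `s = L - W` on `S` and `s = -W` off `S`.
theorem mul_setIntegral_le_entropy_add {Ω : Type*} [MeasurableSpace Ω] {μ : Measure Ω}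
    {g W : Ω → ℝ} (hg : ∀ w, 0 ≤ g w) (hgi : Integrable g μ)
    (hlog : Integrable (fun w => g w * Real.log (g w)) μ) (hW : ∀ w, 0 ≤ W w)
    (hWg : Integrable (fun w => W w * g w) μ) (hexp : Integrable (fun w => Real.exp (-W w)) μ)
    {S : Set Ω} (hS : MeasurableSet S) (hSμ : μ S ≠ ∞) (L : ℝ) :
    L * ∫ w in S, g w ∂μ ≤ (∫ w, g w * Real.log (g w) ∂μ) + (∫ w, W w * g w ∂μ) +
      (∫ w, Real.exp (-W w) ∂μ) + μ.real S * Real.exp L := by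
  have hSi : Integrable (S.indicator fun _ => Real.exp L) μ :=
    (integrable_indicator_iff hS).2 (integrableOn_const hSμ)
  have hpointwise : ∀ w, L * S.indicator g w ≤ g w * Real.log (g w) + W w * g w +
      Real.exp (-W w) + S.indicator (fun _ => Real.exp L) w := fun w => by
    by_cases hw : w ∈ S
    · have hyoung := mul_sub_exp_le_mul_log (hg w) (L - W w)
      have hmono : Real.exp (L - W w) ≤ Real.exp L := Real.exp_le_exp.2 (by linarith [hW w])
      simp only [Set.indicator_of_mem hw]
      linarith [Real.exp_pos (-W w)]
    · have hyoung := mul_sub_exp_le_mul_log (hg w) (-W w)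
      simp only [Set.indicator_of_notMem hw]
      linarith
  calc L * ∫ w in S, g w ∂μ = ∫ w, L * S.indicator g w ∂μ := by
        rw [integral_const_mul, integral_indicator hS]
    _ ≤ ∫ w, g w * Real.log (g w) + W w * g w + Real.exp (-W w) +
          S.indicator (fun _ => Real.exp L) w ∂μ :=
        integral_mono ((hgi.indicator hS).const_mul L) (((hlog.add hWg).add hexp).add hSi)
          hpointwise
    _ = _ := by
        rw [integral_add ((hlog.fun_add hWg).fun_add hexp) hSi,
          integral_add (hlog.fun_add hWg) hexp, integral_add hlog hWg,
          integral_indicator hS, setIntegral_const, smul_eq_mul]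

theorem sq_mul_sub_setIntegral_ball_le {V : Type*} [NormedAddCommGroup V] [MeasurableSpace V]
    [OpensMeasurableSpace V] {μ : Measure V} {g : V → ℝ} (hg : ∀ w, 0 ≤ g w)
    (hgi : Integrable g μ) (henergy : Integrable (fun w => ‖w‖ ^ 2 * g w) μ) {R : ℝ}
    (hR : 0 ≤ R) :
    R ^ 2 * ((∫ w, g w ∂μ) - ∫ w in Metric.ball 0 R, g w ∂μ) ≤ ∫ w, ‖w‖ ^ 2 * g w ∂μ := by
  rw [sub_eq_of_eq_add' (integral_add_compl (measurableSet_ball (x := (0 : V)) (ε := R)) hgi).symm,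
    ← integral_const_mul]
  refine (setIntegral_mono_on (hgi.integrableOn.const_mul _) henergy.integrableOn
    measurableSet_ball.compl fun w hw => ?_).trans
    (setIntegral_le_integral henergy (.of_forall fun w => mul_nonneg (sq_nonneg _) (hg w)))
  have hw : R ≤ ‖w‖ := by simpa using hw
  exact mul_le_mul_of_nonneg_right (pow_le_pow_left₀ hR hw 2) (hg w)

section Slab

variable {V : Type*} [NormedAddCommGroup V] [InnerProductSpace ℝ V]

/-- The open slab of width `2 δ` around the hyperplane `⟨u, w⟩ = a`. -/
def slab (u : V) (a δ : ℝ) : Set V := {w | |inner ℝ u w - a| < δ}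

theorem isOpen_slab (u : V) (a δ : ℝ) : IsOpen (slab u a δ) :=
  isOpen_lt (by fun_prop) continuous_const

variable [FiniteDimensional ℝ V]

theorem exists_orthonormalBasis_apply_eq {n : ℕ} (hn : Module.finrank ℝ V = n + 1) {u : V}
    (hu : ‖u‖ = 1) : ∃ B : OrthonormalBasis (Fin (n + 1)) ℝ V, B 0 = u := by
  obtain ⟨B, hB⟩ := Orthonormal.exists_orthonormalBasis_extension_of_card_eq (𝕜 := ℝ) (E := V)
    (ι := Fin (n + 1)) (by simp [hn]) (v := fun _ => u) (s := {0})
    ⟨fun _ => hu, fun i j hij => (hij (Subsingleton.elim i j)).elim⟩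
  exact ⟨B, hB 0 rfl⟩

theorem volume_ball_inter_slab_le [MeasurableSpace V] [BorelSpace V] {u : V} (hu : ‖u‖ = 1)
    (a δ R : ℝ) :
    volume (Metric.ball 0 R ∩ slab u a δ) ≤
      ENNReal.ofReal (2 * δ) * ENNReal.ofReal (2 * R) ^ (Module.finrank ℝ V - 1) := by
  have : Nontrivial V := ⟨u, 0, by rintro rfl; simp at hu⟩
  obtain ⟨n, hn⟩ := Nat.exists_eq_succ_of_ne_zero (Module.finrank_pos (R := ℝ) (M := V)).ne'
  obtain ⟨B, rfl⟩ := exists_orthonormalBasis_apply_eq hn hu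
  let box : Set (Fin (n + 1) → ℝ) := Set.univ.pi
    (Fin.cons (Set.Ioo (a - δ) (a + δ)) fun _ => Set.Ioo (-R) R)
  have hsub : Metric.ball 0 R ∩ slab (B 0) a δ ⊆ (fun w => WithLp.ofLp (B.repr w)) ⁻¹' box := by
    rintro w ⟨hball, hslab⟩ k -
    simp only [B.repr_apply_apply]
    refine Fin.cases ?_ (fun i => ?_) k
    · have := abs_lt.1 (show |inner ℝ (B 0) w - a| < δ from hslab)
      exact ⟨by linarith, by linarith⟩
    · have hcoord : |inner ℝ (B i.succ) w| ≤ ‖w‖ := by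
        simpa using abs_real_inner_le_norm (B i.succ) w
      exact abs_lt.1 (hcoord.trans_lt (mem_ball_zero_iff.1 hball))
  have hpres : MeasurePreserving (fun w => WithLp.ofLp (B.repr w)) :=
    (PiLp.volume_preserving_ofLp (Fin (n + 1))).comp B.measurePreserving_repr
  have hbox : volume box = ENNReal.ofReal (2 * δ) * ENNReal.ofReal (2 * R) ^ n := by
    rw [volume_pi_pi, Fin.prod_univ_succ]
    simp only [Fin.cons_zero, Fin.cons_succ, Real.volume_Ioo, Finset.prod_const, Finset.card_univ,
      Fintype.card_fin]
    ring_nf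
  calc volume (Metric.ball 0 R ∩ slab (B 0) a δ) ≤ volume box :=
        (measure_mono hsub).trans (hpres.measure_preimage_le _)
    _ = _ := by rw [hbox, hn, Nat.succ_sub_one]

end Slab

theorem integrable_exp_neg_norm_sq {V : Type*} [NormedAddCommGroup V] [InnerProductSpace ℝ V]
    [FiniteDimensional ℝ V] [MeasurableSpace V] [BorelSpace V] :
    Integrable fun w : V => Real.exp (-‖w‖ ^ 2) := by
  refine Integrable.of_integral_ne_zero ?_
  have hgauss := GaussianFourier.integral_rexp_neg_mul_sq_norm (V := V) one_pos
  simp only [neg_mul, one_mul] at hgauss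
  rw [hgauss]
  positivity

theorem integral_normSq_mul {d : ℕ} (g : Vel d → ℝ) :
    ∫ w, ‖w‖ ^ 2 * g w = 2 * energy g := by
  rw [energy]
  ring

theorem exists_setIntegral_le_of_volume_le (d : ℕ) (E H : ℝ) {ε : ℝ} (hε : 0 < ε) :
    ∃ η : ℝ, 0 < η ∧ ∀ g : Vel d → ℝ, IsDensity g → energy g ≤ E → entropy g ≤ H →
      ∀ S : Set (Vel d), MeasurableSet S → volume S ≤ ENNReal.ofReal η → ∫ w in S, g w ≤ ε := by
  set G := ∫ w : Vel d, Real.exp (-‖w‖ ^ 2)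
  obtain ⟨L, hL, hLε⟩ : ∃ L : ℝ, 0 < L ∧ H + 2 * E + G + 1 ≤ L * ε :=
    ⟨max (H + 2 * E + G + 1) 1 / ε, by positivity,
      (le_max_left _ _).trans_eq (div_mul_cancel₀ _ hε.ne').symm⟩
  refine ⟨Real.exp (-L), Real.exp_pos _, fun g hg hE hH S hS hvol => ?_⟩
  have hsmall : volume.real S * Real.exp L ≤ 1 := by
    have := mul_le_mul_of_nonneg_right (ENNReal.toReal_le_of_le_ofReal (Real.exp_pos _).le hvol)
      (Real.exp_pos L).le
    rwa [← Real.exp_add, neg_add_cancel, Real.exp_zero] at this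
  have hmass := mul_setIntegral_le_entropy_add hg.nonneg hg.integrable hg.finite_entropy
    (fun w => sq_nonneg ‖w‖) hg.finite_energy integrable_exp_neg_norm_sq hS
    (hvol.trans_lt ENNReal.ofReal_lt_top).ne L
  rw [integral_normSq_mul] at hmass
  refine le_of_mul_le_mul_left (hmass.trans ?_) hL
  rw [← entropy]
  linarith

theorem exists_le_setIntegral_ball (d : ℕ) (E : ℝ) {ε : ℝ} (hε : 0 < ε) :
    ∃ R : ℝ, 0 < R ∧ ∀ g : Vel d → ℝ, IsDensity g → energy g ≤ E →
      1 - ε ≤ ∫ w in Metric.ball 0 R, g w := by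
  obtain ⟨R, hR, hRE⟩ : ∃ R : ℝ, 0 < R ∧ 2 * E ≤ R ^ 2 * ε := by
    refine ⟨√((2 * |E| + 1) / ε), by positivity, ?_⟩
    rw [Real.sq_sqrt (by positivity), div_mul_cancel₀ _ hε.ne']
    linarith [le_abs_self E]
  refine ⟨R, hR, fun g hg hE => ?_⟩
  have htail := sq_mul_sub_setIntegral_ball_le hg.nonneg hg.integrable hg.finite_energy hR.le
  rw [hg.integral_eq_one, integral_normSq_mul] at htail
  have := le_of_mul_le_mul_left (htail.trans ((mul_le_mul_of_nonneg_left hE two_pos.le).trans hRE))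
    (by positivity)
  linarith

theorem exists_half_le_setIntegral_ball_diff_slab (d : ℕ) (E H : ℝ) :
    ∃ R : ℝ, 0 < R ∧ ∃ δ : ℝ, 0 < δ ∧
      ∀ g : Vel d → ℝ, IsDensity g → energy g ≤ E → entropy g ≤ H →
        ∀ u : Vel d, ‖u‖ = 1 → ∀ a : ℝ, 1 / 2 ≤ ∫ w in Metric.ball 0 R \ slab u a δ, g w := by
  obtain ⟨R, hR, hball⟩ := exists_le_setIntegral_ball d E (ε := 1 / 4) (by norm_num)
  obtain ⟨η, hη, hsmall⟩ := exists_setIntegral_le_of_volume_le d E H (ε := 1 / 4) (by norm_num)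
  refine ⟨R, hR, η / (2 * (2 * R) ^ (d - 1)), by positivity, fun g hg hE hH u hu a => ?_⟩
  set δ := η / (2 * (2 * R) ^ (d - 1))
  have hvol : volume (Metric.ball 0 R ∩ slab u a δ) ≤ ENNReal.ofReal η := by
    refine (volume_ball_inter_slab_le hu a δ R).trans_eq ?_
    rw [finrank_euclideanSpace_fin, ← ENNReal.ofReal_pow (by positivity),
      ← ENNReal.ofReal_mul (by positivity)]
    congr 1
    simp only [δ]
    field_simp
  have hslab := (isOpen_slab u a δ).measurableSet
  have hsplit := integral_inter_add_sdiff (f := g) hslab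
    (hg.integrable.integrableOn (s := Metric.ball 0 R))
  have := hsmall g hg hE hH _ (measurableSet_ball.inter hslab) hvol
  linarith [hball g hg hE]

end NonConcentration

section Coercivity

variable {V : Type*} [NormedAddCommGroup V] [InnerProductSpace ℝ V]

theorem exists_norm_eq_one_inner_eq_zero [FiniteDimensional ℝ V] (hV : 2 ≤ Module.finrank ℝ V)
    (x : V) : ∃ u : V, ‖u‖ = 1 ∧ inner ℝ u x = 0 := by
  have hfinrank := (ℝ ∙ x).finrank_add_finrank_orthogonal
  have hspan : Module.finrank ℝ (ℝ ∙ x) ≤ 1 := by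
    simpa using finrank_span_le_card (R := ℝ) {x}
  have : Nontrivial (ℝ ∙ x)ᗮ := Module.nontrivial_of_finrank_pos (R := ℝ) (by omega)
  obtain ⟨u, hu⟩ := exists_norm_eq (ℝ ∙ x)ᗮ zero_le_one
  exact ⟨u, hu, Submodule.mem_orthogonal_singleton_iff_inner_left.1 u.2⟩

-- Cauchy–Schwarz for `x` and the component of `z` orthogonal to `u`.
theorem inner_sq_mul_normSq_add_inner_sq_le {u x : V} (hu : ‖u‖ = 1) (hux : inner ℝ u x = 0)
    (z : V) : inner ℝ u z ^ 2 * ‖x‖ ^ 2 + inner ℝ z x ^ 2 ≤ ‖z‖ ^ 2 * ‖x‖ ^ 2 := by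
  have hcs := real_inner_mul_inner_self_le (z - inner ℝ u z • u) x
  have hinner : inner ℝ (z - inner ℝ u z • u) x = inner ℝ z x := by
    rw [inner_sub_left, real_inner_smul_left, hux, mul_zero, sub_zero]
  have hnorm : inner ℝ (z - inner ℝ u z • u) (z - inner ℝ u z • u) =
      ‖z‖ ^ 2 - inner ℝ u z ^ 2 := by
    rw [real_inner_self_eq_norm_sq, norm_sub_sq_real, norm_smul, hu, real_inner_smul_right,
      real_inner_comm, Real.norm_eq_abs, mul_one, sq_abs]
    ring
  rw [hinner, hnorm, real_inner_self_eq_norm_sq] at hcs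
  linarith

theorem rpow_neg_abs_mul_rpow_le {K s t : ℝ} (hs : 0 < s) (ht : 0 < t) (hst : s ≤ K * t)
    (hts : t ≤ K * s) (γ : ℝ) : K ^ (-|γ|) * s ^ γ ≤ t ^ γ := by
  have hK : 0 < K := (pos_iff_pos_of_mul_pos (hs.trans_le hst)).2 ht
  rcases le_total 0 γ with hγ | hγ
  · rw [abs_of_nonneg hγ, Real.rpow_neg hK.le, inv_mul_le_iff₀ (by positivity),
      ← Real.mul_rpow hK.le ht.le]
    exact Real.rpow_le_rpow hs.le hst hγ
  · rw [abs_of_nonpos hγ, neg_neg, ← Real.mul_rpow hK.le hs.le]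
    exact Real.rpow_le_rpow_of_nonpos ht hts hγ

variable {d : ℕ}

theorem one_le_jb (v : Vel d) : 1 ≤ jb v :=
  Real.one_le_sqrt.2 (le_add_of_nonneg_right (sq_nonneg _))

theorem jb_pos (v : Vel d) : 0 < jb v :=
  one_pos.trans_le (one_le_jb v)

theorem norm_le_jb (v : Vel d) : ‖v‖ ≤ jb v :=
  Real.le_sqrt_of_sq_le (le_add_of_nonneg_left zero_le_one)

theorem jb_le_one_add_norm (v : Vel d) : jb v ≤ 1 + ‖v‖ := by
  rw [jb, Real.sqrt_le_left (by positivity)]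
  linarith [norm_nonneg v, add_sq 1 ‖v‖]

theorem exists_mul_jb_rpow_le (γ : ℝ) {R δ : ℝ} (hR : 0 < R) (hδ : 0 < δ) :
    ∃ c : ℝ, 0 < c ∧ ∀ v w : Vel d, ‖w‖ < R → δ ≤ ‖v - w‖ → c * jb v ^ γ ≤ ‖v - w‖ ^ γ := by
  set K := (1 + R) / δ + (1 + R)
  refine ⟨K ^ (-|γ|), by positivity, fun v w hw hδw => ?_⟩
  have hz : 0 < ‖v - w‖ := hδ.trans_le hδw
  refine rpow_neg_abs_mul_rpow_le (jb_pos v) hz ?_ ?_ γ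
  · have hscaled : 1 + R ≤ (1 + R) / δ * ‖v - w‖ := by
      rw [div_mul_eq_mul_div, le_div_iff₀ hδ]
      gcongr
    calc jb v ≤ 1 + (R + ‖v - w‖) := by
          linarith [jb_le_one_add_norm v, norm_le_norm_add_norm_sub w v, norm_sub_rev v w]
      _ ≤ (1 + R) / δ * ‖v - w‖ + ‖v - w‖ := by linarith
      _ ≤ K * ‖v - w‖ := by
          rw [add_mul]
          gcongr
          exact le_mul_of_one_le_left hz.le (by linarith)
  · calc ‖v - w‖ ≤ jb v + R := by linarith [norm_sub_le v w, norm_le_jb v]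
      _ ≤ (1 + R) * jb v := by nlinarith [one_le_jb v]
      _ ≤ K * jb v := by
          gcongr
          · exact (jb_pos v).le
          · exact le_add_of_nonneg_left (by positivity)

theorem inner_A_apply_self (γ : ℝ) (z x : Vel d) :
    inner ℝ x (A γ z x) = ‖z‖ ^ γ * (‖z‖ ^ 2 * ‖x‖ ^ 2 - inner ℝ z x ^ 2) := by
  rw [A_apply, inner_smul_right, inner_sub_right, inner_smul_right, inner_smul_right,
    real_inner_self_eq_norm_sq, real_inner_comm]
  ring

theorem inner_A_apply_self_nonneg (γ : ℝ) (z x : Vel d) : 0 ≤ inner ℝ x (A γ z x) := by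
  rw [inner_A_apply_self, ← mul_pow]
  exact mul_nonneg (Real.rpow_nonneg (norm_nonneg _) _)
    (sub_nonneg.2 (sq_le_sq' (neg_le_of_abs_le (abs_real_inner_le_norm z x))
      (real_inner_le_norm z x)))

theorem mul_normSq_le_inner_A_apply_self {u x : Vel d} (hu : ‖u‖ = 1) (hux : inner ℝ u x = 0)
    (γ : ℝ) (z : Vel d) : ‖z‖ ^ γ * inner ℝ u z ^ 2 * ‖x‖ ^ 2 ≤ inner ℝ x (A γ z x) := by
  rw [inner_A_apply_self, mul_assoc]
  gcongr
  linarith [inner_sq_mul_normSq_add_inner_sq_le hu hux z]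

theorem A_eq_zero (hd : d < 2) (γ : ℝ) (z : Vel d) : A γ z = 0 := by
  have : Subsingleton (Fin d) := Fin.subsingleton_iff_le_one.2 (by omega)
  ext x i
  have hzero : ‖z‖ ^ 2 * x i - inner ℝ z x * z i = 0 := by
    rw [EuclideanSpace.real_norm_sq_eq, PiLp.inner_apply, Fintype.sum_subsingleton _ i,
      Fintype.sum_subsingleton _ i, real_inner_eq_re_inner]
    simp
    ring
  simp [A_apply, hzero]

section ConvA

variable {γ : ℝ} {h : Vel d → ℝ} {v : Vel d}

theorem ConvAExistsAt.integrable_apply (hA : ConvAExistsAt γ h v) (x : Vel d) :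
    Integrable fun w => h w • A γ (v - w) x :=
  (ContinuousLinearMap.apply ℝ (Vel d) x).integrable_comp (φ := fun w => h w • A γ (v - w)) hA

theorem convA_apply (hA : ConvAExistsAt γ h v) (x : Vel d) :
    convA γ h v x = ∫ w, h w • A γ (v - w) x :=
  ContinuousLinearMap.integral_apply (φ := fun w => h w • A γ (v - w)) hA x

theorem ConvAExistsAt.integrable_mul_inner (hA : ConvAExistsAt γ h v) (x : Vel d) :
    Integrable fun w => h w * inner ℝ x (A γ (v - w) x) := by
  simpa only [real_inner_smul_right] using (hA.integrable_apply x).const_inner (𝕜 := ℝ) x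

theorem quadNormSq_convA (hA : ConvAExistsAt γ h v) (x : Vel d) :
    quadNormSq (convA γ h v) x = ∫ w, h w * inner ℝ x (A γ (v - w) x) := by
  rw [quadNormSq, convA_apply hA, ← integral_inner (hA.integrable_apply x)]
  simp only [real_inner_smul_right]

end ConvA

theorem exists_mul_normSq_le_quadNormSq_convA (hd : 2 ≤ d) (γ E H : ℝ) :
    ∃ c : ℝ, 0 < c ∧ ∀ g : Vel d → ℝ, IsDensity g → energy g ≤ E → entropy g ≤ H →
      ∀ v : Vel d, ConvAExistsAt γ g v → ∀ x : Vel d,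
        c * jb v ^ γ * ‖x‖ ^ 2 ≤ quadNormSq (convA γ g v) x := by
  obtain ⟨R, hR, δ, hδ, hmass⟩ := exists_half_le_setIntegral_ball_diff_slab d E H
  obtain ⟨c, hc, hjb⟩ := exists_mul_jb_rpow_le (d := d) γ hR hδ
  refine ⟨c * δ ^ 2 / 2, by positivity, fun g hg hE hH v hA x => ?_⟩
  obtain ⟨u, hu, hux⟩ := exists_norm_eq_one_inner_eq_zero (by simpa using hd) x
  set T := Metric.ball 0 R \ slab u (inner ℝ u v) δ
  have hT : MeasurableSet T := measurableSet_ball.diff (isOpen_slab _ _ _).measurableSet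
  set κ := c * jb v ^ γ * δ ^ 2 * ‖x‖ ^ 2
  have hκ : 0 ≤ κ := by
    have := jb_pos v
    positivity
  have hlower : ∀ w ∈ T, κ ≤ inner ℝ x (A γ (v - w) x) := by
    rintro w ⟨hball, hslab⟩
    have hδu : δ ≤ |inner ℝ u (v - w)| := by
      rw [inner_sub_right, abs_sub_comm]
      exact not_lt.1 hslab
    have hδz : δ ≤ ‖v - w‖ := hδu.trans <| by simpa [hu] using abs_real_inner_le_norm u (v - w)
    have hsq : δ ^ 2 ≤ inner ℝ u (v - w) ^ 2 := by
      rw [← sq_abs (inner ℝ u (v - w))]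
      gcongr
    refine le_trans ?_ (mul_normSq_le_inner_A_apply_self hu hux γ (v - w))
    exact mul_le_mul_of_nonneg_right (mul_le_mul (hjb v w (mem_ball_zero_iff.1 hball) hδz) hsq
      (sq_nonneg δ) (Real.rpow_nonneg (norm_nonneg _) _)) (sq_nonneg _)
  have hpairing := hA.integrable_mul_inner x
  calc c * δ ^ 2 / 2 * jb v ^ γ * ‖x‖ ^ 2 = (1 / 2) * κ := by ring
    _ ≤ (∫ w in T, g w) * κ := by
        gcongr
        exact hmass g hg hE hH u hu _
    _ = ∫ w in T, g w * κ := (integral_mul_const _ _).symm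
    _ ≤ ∫ w in T, g w * inner ℝ x (A γ (v - w) x) :=
        setIntegral_mono_on (hg.integrable.integrableOn.mul_const _) hpairing.integrableOn hT
          fun w hw => mul_le_mul_of_nonneg_left (hlower w hw) (hg.nonneg w)
    _ ≤ ∫ w, g w * inner ℝ x (A γ (v - w) x) :=
        setIntegral_le_integral hpairing
          (.of_forall fun w => mul_nonneg (hg.nonneg w) (inner_A_apply_self_nonneg _ _ _))
    _ = quadNormSq (convA γ g v) x := (quadNormSq_convA hA x).symm

end Coercivity

section VelocityField

variable {d : ℕ} {γ : ℝ} {f g : Vel d → ℝ} {v : Vel d}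

-- A zero of a nonnegative function is a minimum, so its gradient vanishes there.
theorem smul_score (hf : ∀ w, 0 ≤ f w) (hfd : DifferentiableAt ℝ f v) :
    f v • score f v = gradient f v := by
  rcases (hf v).eq_or_lt with hzero | hpos
  · have hmin : IsLocalMin f v := .of_forall fun w => hzero ▸ hf w
    rw [← hzero, zero_smul, gradient, hmin.fderiv_eq_zero, map_zero]
  · rw [score, gradient, fderiv.log hfd hpos.ne', map_smul, smul_smul, mul_inv_cancel₀ hpos.ne',
      one_smul, gradient]

theorem gradient_sub (hf : DifferentiableAt ℝ f v) (hg : DifferentiableAt ℝ g v) :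
    gradient (f - g) v = gradient f v - gradient g v := by
  rw [gradient, fderiv_sub hf hg, map_sub, gradient, gradient]

theorem relScore_eq_sub (hf : DifferentiableAt ℝ f v) (hg : DifferentiableAt ℝ g v)
    (hfv : f v ≠ 0) (hgv : g v ≠ 0) : relScore f g v = score f v - score g v := by
  have hlog : (fun w => Real.log (f w / g w)) =ᶠ[nhds v]
      (fun w => Real.log (f w)) - fun w => Real.log (g w) := by
    filter_upwards [hf.continuousAt.eventually_ne hfv, hg.continuousAt.eventually_ne hgv]
      with w hfw hgw using Real.log_div hfw hgw
  rw [relScore, gradient, hlog.fderiv_eq, ← gradient, gradient_sub (hf.log hfv) (hg.log hgv),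
    score, score]

theorem fieldIntegrand_eq_sub (hf : ∀ w, 0 ≤ f w) (hfd : Differentiable ℝ f) (γ : ℝ)
    (v w : Vel d) :
    fieldIntegrand γ f v w = f w • A γ (v - w) (score f v) - A γ (v - w) (gradient f w) := by
  rw [fieldIntegrand, map_sub, smul_sub, ← smul_score hf (hfd w), map_smul]

theorem ConvAExistsAt.integrable_A_apply_gradient (hA : ConvAExistsAt γ f v)
    (hf : ∀ w, 0 ≤ f w) (hfd : Differentiable ℝ f) (hU : Integrable (fieldIntegrand γ f v)) :
    Integrable fun w => A γ (v - w) (gradient f w) :=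
  ((hA.integrable_apply (score f v)).sub hU).congr <| .of_forall fun w => by
    simp [fieldIntegrand_eq_sub hf hfd]

theorem U_eq_neg_convA_apply_add (hf : ∀ w, 0 ≤ f w) (hfd : Differentiable ℝ f)
    (hA : ConvAExistsAt γ f v) (hU : Integrable (fieldIntegrand γ f v)) :
    U γ f v = -convA γ f v (score f v) + ∫ w, A γ (v - w) (gradient f w) := by
  simp only [U, fieldIntegrand_eq_sub hf hfd]
  rw [integral_sub (hA.integrable_apply _) (hA.integrable_A_apply_gradient hf hfd hU),
    ← convA_apply hA, neg_sub, neg_add_eq_sub]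

theorem ConvAExistsAt.of_sub (hA : ConvAExistsAt γ (f - g) v) (hAg : ConvAExistsAt γ g v) :
    ConvAExistsAt γ f v := by
  refine (Integrable.fun_add hA hAg).congr (.of_forall fun w => ?_)
  simp

theorem convA_sub (hAf : ConvAExistsAt γ f v) (hAg : ConvAExistsAt γ g v) :
    convA γ (f - g) v = convA γ f v - convA γ g v := by
  rw [convA, convA, convA, convolution_def, convolution_def, convolution_def,
    ← integral_sub hAf.integrable hAg.integrable]
  simp only [Pi.sub_apply, map_sub, sub_apply]

theorem U_sub_U (hf : ∀ w, 0 ≤ f w) (hg : ∀ w, 0 ≤ g w) (hfd : Differentiable ℝ f)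
    (hgd : Differentiable ℝ g) (hUf : Integrable (fieldIntegrand γ f v))
    (hUg : Integrable (fieldIntegrand γ g v)) (hAg : ConvAExistsAt γ g v)
    (hA : ConvAExistsAt γ (f - g) v) (hB : ConvBExistsAt γ (f - g) v) :
    U γ f v - U γ g v = -convA γ (f - g) v (score f v) -
      convA γ g v (score f v - score g v) + convB γ (f - g) v := by
  have hAf := hA.of_sub hAg
  have hgradf := hAf.integrable_A_apply_gradient hf hfd hUf
  have hgradg := hAg.integrable_A_apply_gradient hg hgd hUg
  have hgrad (w : Vel d) : A γ (v - w) (gradient (f - g) w) =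
      A γ (v - w) (gradient f w) - A γ (v - w) (gradient g w) := by
    rw [gradient_sub (hfd w) (hgd w), map_sub]
  have hparts := integral_A_apply_gradient (hfd.sub hgd) v
    (by simp only [hgrad]; exact hgradf.sub hgradg) hB
  simp only [hgrad] at hparts
  rw [integral_sub hgradf hgradg] at hparts
  have hconvB : convB γ (f - g) v = ∫ w, (f - g) w • b γ (v - w) := rfl
  rw [U_eq_neg_convA_apply_add hf hfd hAf hUf, U_eq_neg_convA_apply_add hg hgd hAg hUg,
    convA_sub hAf hAg, hconvB, ← hparts, sub_apply, map_sub]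
  abel

end VelocityField

section Absorption

theorem mul_le_mul_sq_add_inv_mul_sq {κ : ℝ} (hκ : 0 < κ) (a s : ℝ) :
    a * s ≤ κ / 4 * s ^ 2 + κ⁻¹ * a ^ 2 := by
  have hsq : κ / 4 * s ^ 2 + κ⁻¹ * a ^ 2 - a * s = κ⁻¹ * (κ / 2 * s - a) ^ 2 := by
    field_simp
    ring
  linarith [show 0 ≤ κ⁻¹ * (κ / 2 * s - a) ^ 2 by positivity]

theorem inner_le_neg_half_add {V : Type*} [NormedAddCommGroup V] [InnerProductSpace ℝ V]
    {m s σ β : V} {L : V →L[ℝ] V} {κ : ℝ} (hκ : 0 < κ) (hm : κ * ‖s‖ ^ 2 ≤ inner ℝ s m) :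
    inner ℝ (-L σ - m + β) s ≤
      -(1 / 2) * inner ℝ s m + κ⁻¹ * (‖L‖ ^ 2 * ‖σ‖ ^ 2) + κ⁻¹ * ‖β‖ ^ 2 := by
  have hσ : -inner ℝ (L σ) s ≤ ‖L‖ * ‖σ‖ * ‖s‖ :=
    (neg_le_abs _).trans <| (abs_real_inner_le_norm _ _).trans <| by
      gcongr
      exact L.le_opNorm σ
  have hβ : inner ℝ β s ≤ ‖β‖ * ‖s‖ := real_inner_le_norm _ _
  have hyoungσ := mul_le_mul_sq_add_inv_mul_sq hκ (‖L‖ * ‖σ‖) ‖s‖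
  have hyoungβ := mul_le_mul_sq_add_inv_mul_sq hκ ‖β‖ ‖s‖
  rw [inner_add_left, inner_sub_left, inner_neg_left, real_inner_comm s m, ← mul_pow]
  linarith

variable {d : ℕ} {γ : ℝ} {f : Vel d → ℝ}

theorem diffusionErrorIntegrand_nonneg (hf : ∀ v, 0 ≤ f v) (g : Vel d → ℝ) (v : Vel d) :
    0 ≤ diffusionErrorIntegrand γ f g v := by
  have := hf v
  have := (jb_pos v).le
  unfold diffusionErrorIntegrand
  positivity

theorem driftErrorIntegrand_nonneg (hf : ∀ v, 0 ≤ f v) (g : Vel d → ℝ) (v : Vel d) :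
    0 ≤ driftErrorIntegrand γ f g v := by
  have := hf v
  have := (jb_pos v).le
  unfold driftErrorIntegrand
  positivity

-- In dimension at most one the kernel `A` vanishes, and so do both sides.
theorem lhsIntegrand_le_of_lt_two (hd : d < 2) (hf : ∀ v, 0 ≤ f v) (g : Vel d → ℝ) (v : Vel d) :
    lhsIntegrand γ f g v ≤ -(1 / 2) * dissipationIntegrand γ f g v +
      diffusionErrorIntegrand γ f g v + driftErrorIntegrand γ f g v := by
  have hlhs : lhsIntegrand γ f g v = 0 := by
    simp [lhsIntegrand, U, fieldIntegrand, A_eq_zero hd]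
  have hdissipation : dissipationIntegrand γ f g v = 0 := by
    simp [dissipationIntegrand, quadNormSq, convA, convolution_def, A_eq_zero hd]
  linarith [diffusionErrorIntegrand_nonneg (γ := γ) hf g v,
    driftErrorIntegrand_nonneg (γ := γ) hf g v]

theorem lhsIntegrand_le {g : Vel d → ℝ} {v : Vel d} {c : ℝ} (hc : 0 < c)
    (hf : ∀ v, 0 ≤ f v) (hg : ∀ v, 0 ≤ g v) (hfd : Differentiable ℝ f) (hgd : Differentiable ℝ g)
    (hfv : 0 < f v) (hgv : 0 < g v)
    (hUf : Integrable (fieldIntegrand γ f v)) (hUg : Integrable (fieldIntegrand γ g v))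
    (hAg : ConvAExistsAt γ g v) (hA : ConvAExistsAt γ (f - g) v) (hB : ConvBExistsAt γ (f - g) v)
    (hcoercive : ∀ x, c * jb v ^ γ * ‖x‖ ^ 2 ≤ quadNormSq (convA γ g v) x) :
    lhsIntegrand γ f g v ≤ -(1 / 2) * dissipationIntegrand γ f g v +
      c⁻¹ * diffusionErrorIntegrand γ f g v + c⁻¹ * driftErrorIntegrand γ f g v := by
  have hjb := jb_pos v
  have hpairing : inner ℝ (U γ f v - U γ g v) (relScore f g v) ≤
      -(1 / 2) * quadNormSq (convA γ g v) (relScore f g v) +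
        (c * jb v ^ γ)⁻¹ * (‖convA γ (f - g) v‖ ^ 2 * ‖score f v‖ ^ 2) +
        (c * jb v ^ γ)⁻¹ * ‖convB γ (f - g) v‖ ^ 2 := by
    rw [U_sub_U hf hg hfd hgd hUf hUg hAg hA hB,
      ← relScore_eq_sub (hfd v) (hgd v) hfv.ne' hgv.ne']
    exact inner_le_neg_half_add (by positivity) (hcoercive _)
  rw [mul_inv, ← Real.rpow_neg hjb.le] at hpairing
  rw [lhsIntegrand, dissipationIntegrand, diffusionErrorIntegrand, driftErrorIntegrand]
  refine (mul_le_mul_of_nonneg_left hpairing hfv.le).trans_eq ?_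
  ring

theorem exists_lhsIntegrand_le (d : ℕ) (γ E H : ℝ) :
    ∃ C : ℝ, 0 < C ∧ ∀ f g : Vel d → ℝ, (∀ v, 0 ≤ f v) → Differentiable ℝ f → IsDensity g →
      energy g ≤ E → entropy g ≤ H → LhsFinite γ f g → RhsFinite γ f g →
      ∀ᵐ v, lhsIntegrand γ f g v ≤ -(1 / 2) * dissipationIntegrand γ f g v +
        C * diffusionErrorIntegrand γ f g v + C * driftErrorIntegrand γ f g v := by
  rcases lt_or_ge d 2 with hd | hd
  · refine ⟨1, one_pos, fun f g hf _ _ _ _ _ _ => .of_forall fun v => ?_⟩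
    simpa only [one_mul] using lhsIntegrand_le_of_lt_two hd hf g v
  obtain ⟨c, hc, hcoercive⟩ := exists_mul_normSq_le_quadNormSq_convA hd γ E H
  refine ⟨c⁻¹, inv_pos.2 hc, fun f g hf hfd hg hE hH hL hR => ?_⟩
  filter_upwards [hL.pos, hL.field_left, hL.field_right, hR.convA_right, hR.convA_sub,
    hR.convB_sub] with v hpos hUf hUg hAg hA hB
  rcases (hf v).eq_or_lt with hzero | hfv
  · simp [lhsIntegrand, dissipationIntegrand, diffusionErrorIntegrand, driftErrorIntegrand,
      ← hzero]
  · exact lhsIntegrand_le hc hf hg.nonneg hfd hg.differentiable hfv (hpos hfv) (hUf hfv) (hUg hfv)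
      (hAg hfv) (hA hfv) (hB hfv) (hcoercive g hg hE hH v (hAg hfv))

theorem exists_integral_lhsIntegrand_le (d : ℕ) (γ E H : ℝ) :
    ∃ C : ℝ, 0 < C ∧ ∀ f g : Vel d → ℝ, (∀ v, 0 ≤ f v) → Differentiable ℝ f → IsDensity g →
      energy g ≤ E → entropy g ≤ H → LhsFinite γ f g → RhsFinite γ f g →
      (∫ v, lhsIntegrand γ f g v) ≤ -(1 / 2) * (∫ v, dissipationIntegrand γ f g v) +
        C * (∫ v, diffusionErrorIntegrand γ f g v) + C * (∫ v, driftErrorIntegrand γ f g v) := by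
  obtain ⟨C, hC, hpointwise⟩ := exists_lhsIntegrand_le d γ E H
  refine ⟨C, hC, fun f g hf hfd hg hE hH hL hR => ?_⟩
  have hdissipation := hR.dissipation.const_mul (-(1 / 2))
  have hdiffusion := hR.diffusionError.const_mul C
  have hdrift := hR.driftError.const_mul C
  rw [← integral_const_mul, ← integral_const_mul, ← integral_const_mul,
    ← integral_add hdissipation hdiffusion, ← integral_add (hdissipation.fun_add hdiffusion) hdrift]
  exact integral_mono_ae hL.integrable ((hdissipation.fun_add hdiffusion).fun_add hdrift)
    (hpointwise f g hf hfd hg hE hH hL hR)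

end Absorption

section ConvolutionEstimates

theorem eLpNorm_two_sq {α ε : Type*} [MeasurableSpace α] [ENorm ε] (f : α → ε) (μ : Measure α) :
    eLpNorm f 2 μ ^ 2 = ∫⁻ x, ‖f x‖ₑ ^ 2 ∂μ := by
  simpa using eLpNorm_nnreal_pow_eq_lintegral (μ := μ) (f := f) two_ne_zero

theorem lintegral_mul_le_eLpNorm_two_mul {α : Type*} [MeasurableSpace α] {μ : Measure α}
    {f g : α → ℝ≥0∞} (hf : AEMeasurable f μ) (hg : AEMeasurable g μ) :
    ∫⁻ x, f x * g x ∂μ ≤ eLpNorm f 2 μ * eLpNorm g 2 μ := by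
  simpa [eLpNorm_eq_lintegral_rpow_enorm_toReal] using
    ENNReal.lintegral_mul_le_Lp_mul_Lq μ Real.HolderConjugate.two_two hf hg

theorem ennreal_add_sq_le (a b : ℝ≥0∞) : (a + b) ^ 2 ≤ 2 * (a ^ 2 + b ^ 2) := by
  simpa [show (2 - 1 : ℝ) = 1 by norm_num] using
    ENNReal.rpow_add_le_mul_rpow_add_rpow a b one_le_two

variable {G : Type*} [AddCommGroup G] [MeasurableSpace G] [MeasurableAdd₂ G]
  {μ : Measure G} [μ.IsAddLeftInvariant] {F h k : G → ℝ≥0∞}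

theorem eLpNorm_two_comp_sub_right_sq (hk : Measurable k) (w : G) :
    eLpNorm (fun v => k (v - w) ^ 2) 2 μ = eLpNorm k 4 μ ^ 2 := by
  have hpow := eLpNorm_enorm_rpow (μ := μ) (p := 2) (fun v => k (v - w)) zero_lt_two
  have htranslate := eLpNorm_comp_measurePreserving (p := 4) hk.aestronglyMeasurable
    (measurePreserving_sub_right μ w)
  norm_num at hpow
  rw [hpow, ← htranslate]
  rfl

variable [MeasurableNeg G]

theorem lintegral_mul_comp_sub_right_sq_le (hF : Measurable F) (hk : Measurable k) (w : G) :
    ∫⁻ v, F v * k (v - w) ^ 2 ∂μ ≤ eLpNorm F 2 μ * eLpNorm k 4 μ ^ 2 := by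
  rw [← eLpNorm_two_comp_sub_right_sq hk w]
  exact lintegral_mul_le_eLpNorm_two_mul hF.aemeasurable (by fun_prop)

theorem lintegral_mul_lintegral_mul_comp_sub_sq_le [SFinite μ] (hF : Measurable F)
    (hh : Measurable h) (hk : Measurable k) :
    ∫⁻ v, F v * ∫⁻ w, h w * k (v - w) ^ 2 ∂μ ∂μ ≤
      (∫⁻ w, h w ∂μ) * (eLpNorm F 2 μ * eLpNorm k 4 μ ^ 2) := by
  calc ∫⁻ v, F v * ∫⁻ w, h w * k (v - w) ^ 2 ∂μ ∂μ
      = ∫⁻ v, ∫⁻ w, F v * (h w * k (v - w) ^ 2) ∂μ ∂μ :=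
        lintegral_congr fun v => (lintegral_const_mul _ (by fun_prop)).symm
    _ = ∫⁻ w, ∫⁻ v, F v * (h w * k (v - w) ^ 2) ∂μ ∂μ :=
        lintegral_lintegral_swap (by fun_prop)
    _ = ∫⁻ w, h w * ∫⁻ v, F v * k (v - w) ^ 2 ∂μ ∂μ := by
        refine lintegral_congr fun w => ?_
        rw [← lintegral_const_mul _ (by fun_prop)]
        exact lintegral_congr fun v => by ring
    _ ≤ ∫⁻ w, h w * (eLpNorm F 2 μ * eLpNorm k 4 μ ^ 2) ∂μ := by
        gcongr with w
        exact lintegral_mul_comp_sub_right_sq_le hF hk w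
    _ = _ := lintegral_mul_const _ hh

variable [μ.IsNegInvariant]

theorem eLpNorm_two_comp_sub_left_sq (hk : Measurable k) (v : G) :
    eLpNorm (fun w => k (v - w) ^ 2) 2 μ = eLpNorm k 4 μ ^ 2 := by
  have hpow := eLpNorm_enorm_rpow (μ := μ) (p := 2) (fun w => k (v - w)) zero_lt_two
  have htranslate := eLpNorm_comp_measurePreserving (p := 4) hk.aestronglyMeasurable
    (Measure.measurePreserving_sub_left μ v)
  norm_num at hpow
  rw [hpow, ← htranslate]
  rfl

theorem lintegral_mul_comp_sub_left_sq_le (hh : Measurable h) (hk : Measurable k) (v : G) :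
    ∫⁻ w, h w * k (v - w) ^ 2 ∂μ ≤ eLpNorm h 2 μ * eLpNorm k 4 μ ^ 2 := by
  rw [← eLpNorm_two_comp_sub_left_sq hk v]
  exact lintegral_mul_le_eLpNorm_two_mul hh.aemeasurable (by fun_prop)

theorem sq_lintegral_mul_comp_sub_left_cube_le (hh : Measurable h) (hk : Measurable k) (v : G) :
    (∫⁻ w, h w * k (v - w) ^ 3 ∂μ) ^ 2 ≤
      eLpNorm k 4 μ ^ 4 * ∫⁻ w, h w ^ 2 * k (v - w) ^ 2 ∂μ := by
  have hcs : ∫⁻ w, h w * k (v - w) ^ 3 ∂μ ≤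
      eLpNorm (fun w => h w * k (v - w)) 2 μ * eLpNorm k 4 μ ^ 2 := by
    rw [← eLpNorm_two_comp_sub_left_sq hk v]
    refine le_of_eq_of_le (lintegral_congr fun w => ?_)
      (lintegral_mul_le_eLpNorm_two_mul (by fun_prop) (by fun_prop))
    ring
  calc (∫⁻ w, h w * k (v - w) ^ 3 ∂μ) ^ 2
      ≤ (eLpNorm (fun w => h w * k (v - w)) 2 μ * eLpNorm k 4 μ ^ 2) ^ 2 := by gcongr
    _ = eLpNorm k 4 μ ^ 4 * eLpNorm (fun w => h w * k (v - w)) 2 μ ^ 2 := by ring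
    _ = _ := by simp only [eLpNorm_two_sq, enorm_eq_self, mul_pow]

theorem lintegral_mul_sq_lintegral_mul_comp_sub_cube_le [SFinite μ] (hF : Measurable F)
    (hh : Measurable h) (hk : Measurable k) :
    ∫⁻ v, F v * (∫⁻ w, h w * k (v - w) ^ 3 ∂μ) ^ 2 ∂μ ≤
      eLpNorm k 4 μ ^ 6 * eLpNorm h 2 μ ^ 2 * eLpNorm F 2 μ := by
  have hinner : Measurable fun v => ∫⁻ w, h w ^ 2 * k (v - w) ^ 2 ∂μ :=
    Measurable.lintegral_prod_right (by fun_prop)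
  calc ∫⁻ v, F v * (∫⁻ w, h w * k (v - w) ^ 3 ∂μ) ^ 2 ∂μ
      ≤ ∫⁻ v, F v * (eLpNorm k 4 μ ^ 4 * ∫⁻ w, h w ^ 2 * k (v - w) ^ 2 ∂μ) ∂μ := by
        gcongr with v
        exact sq_lintegral_mul_comp_sub_left_cube_le hh hk v
    _ = eLpNorm k 4 μ ^ 4 * ∫⁻ v, F v * ∫⁻ w, h w ^ 2 * k (v - w) ^ 2 ∂μ ∂μ := by
        rw [← lintegral_const_mul _ (by exact hF.mul hinner)]
        exact lintegral_congr fun v => by ring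
    _ ≤ eLpNorm k 4 μ ^ 4 * ((∫⁻ w, h w ^ 2 ∂μ) * (eLpNorm F 2 μ * eLpNorm k 4 μ ^ 2)) := by
        gcongr
        exact lintegral_mul_lintegral_mul_comp_sub_sq_le hF (hh.pow_const 2) hk
    _ = eLpNorm k 4 μ ^ 6 * eLpNorm h 2 μ ^ 2 * eLpNorm F 2 μ := by
        simp only [eLpNorm_two_sq h, enorm_eq_self]
        ring

end ConvolutionEstimates

section TruncatedPower

variable {V : Type*} [NormedAddCommGroup V]

/-- The truncated power `|z|^{-2/3} 1_{|z| < 1}`. The exponent is chosen so that its square and its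
cube dominate the singular parts of the Coulomb kernels `A` and `b` in dimension three, while its
fourth power remains integrable. -/
noncomputable def truncPow : V → ℝ≥0∞ :=
  (Metric.ball 0 1).indicator fun z => ENNReal.ofReal (‖z‖ ^ (-(2 / 3) : ℝ))

theorem ofReal_norm_rpow_neg_le (z : V) {s : ℝ} {m : ℕ} (hs : 0 ≤ s) (hsm : 3 * s ≤ 2 * m) :
    ENNReal.ofReal (‖z‖ ^ (-s)) ≤ truncPow z ^ m + 1 := by
  rcases eq_or_ne z 0 with rfl | hz
  · refine le_add_left (ENNReal.ofReal_le_one.2 ?_)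
    rw [norm_zero]
    exact Real.zero_rpow_le_one _
  have hnorm : 0 < ‖z‖ := norm_pos_iff.2 hz
  rcases lt_or_ge ‖z‖ 1 with hlt | hge
  · refine le_add_right ?_
    rw [truncPow, Set.indicator_of_mem (mem_ball_zero_iff.2 hlt),
      ← ENNReal.ofReal_pow (by positivity), ← Real.rpow_mul_natCast hnorm.le]
    exact ENNReal.ofReal_le_ofReal
      (Real.rpow_le_rpow_of_exponent_ge hnorm hlt.le (by linarith))
  · exact le_add_left (ENNReal.ofReal_le_one.2
      (Real.rpow_le_one_of_one_le_of_nonpos hge (neg_nonpos.2 hs)))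

variable [MeasurableSpace V] [BorelSpace V]

theorem measurable_truncPow : Measurable (truncPow : V → ℝ≥0∞) :=
  (measurable_norm.pow_const _).ennreal_ofReal.indicator measurableSet_ball

variable [NormedSpace ℝ V] [FiniteDimensional ℝ V] (μ : Measure V) [μ.IsAddHaarMeasure]

theorem lintegral_truncPow_pow_lt_top {m : ℕ} (hm : m ≠ 0) (hmV : 2 * m < 3 * Module.finrank ℝ V) :
    ∫⁻ z, truncPow z ^ m ∂μ < ∞ := by
  have hpow (z : V) : truncPow z ^ m =
      (Metric.ball 0 1).indicator (fun z => ENNReal.ofReal (‖z‖ ^ (-(2 / 3 * m) : ℝ))) z := by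
    by_cases hz : z ∈ Metric.ball (0 : V) 1
    · rw [truncPow, Set.indicator_of_mem hz, Set.indicator_of_mem hz,
        ← ENNReal.ofReal_pow (by positivity), ← Real.rpow_mul_natCast (norm_nonneg z), neg_mul]
    · rw [truncPow, Set.indicator_of_notMem hz, Set.indicator_of_notMem hz, zero_pow hm]
  have hexponent : (2 / 3 * m : ℝ) < Module.finrank ℝ V := by
    have : (2 * m : ℝ) < 3 * Module.finrank ℝ V := mod_cast hmV
    linarith
  have hint : IntegrableOn (fun z : V => ‖z‖ ^ (-(2 / 3 * m) : ℝ)) (Metric.ball 0 1) μ :=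
    integrableOn_ball_of_norm_le_rpow (C := 1) (by omega) hexponent
      (.of_forall fun z => by rw [one_mul, Real.norm_of_nonneg (by positivity)])
      (measurable_norm.pow_const _).aestronglyMeasurable
  simp only [hpow]
  rw [lintegral_indicator measurableSet_ball]
  exact hint.lintegral_lt_top

theorem eLpNorm_truncPow_four_lt_top (hV : 3 ≤ Module.finrank ℝ V) :
    eLpNorm (truncPow : V → ℝ≥0∞) 4 μ < ∞ := by
  rw [eLpNorm_lt_top_iff_lintegral_rpow_enorm_lt_top (by norm_num) (by norm_num)]
  simpa using lintegral_truncPow_pow_lt_top μ four_ne_zero (by omega)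

end TruncatedPower

section KernelBounds

variable {d : ℕ}

theorem norm_A_le (γ : ℝ) (z : Vel d) : ‖A γ z‖ ≤ ‖z‖ ^ (γ + 2) := by
  rcases eq_or_ne z 0 with rfl | hz
  · rw [show A γ (0 : Vel d) = 0 by ext1 x; simp [A_apply], norm_zero]
    positivity
  refine ContinuousLinearMap.opNorm_le_bound _ (by positivity) fun x => ?_
  have hproj : ‖‖z‖ ^ 2 • x - inner ℝ z x • z‖ ≤ ‖z‖ ^ 2 * ‖x‖ := by
    refine le_of_sq_le_sq ?_ (by positivity)
    rw [norm_sub_sq_real, norm_smul, norm_smul, real_inner_smul_left, real_inner_smul_right,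
      real_inner_comm, Real.norm_eq_abs, Real.norm_eq_abs, mul_pow, mul_pow, sq_abs, sq_abs]
    nlinarith [mul_nonneg (sq_nonneg ‖z‖) (sq_nonneg (inner ℝ z x))]
  rw [A_apply, norm_smul, Real.norm_of_nonneg (by positivity), Real.rpow_add (norm_pos_iff.2 hz),
    Real.rpow_two, mul_assoc]
  gcongr

theorem norm_b_le (γ : ℝ) (z : Vel d) : ‖b γ z‖ ≤ |(d : ℝ) - 1| * ‖z‖ ^ (γ + 1) := by
  rcases eq_or_ne z 0 with rfl | hz
  · simp only [b, smul_zero, norm_zero]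
    positivity
  rw [b, norm_smul, norm_mul, norm_neg, Real.norm_eq_abs, Real.norm_of_nonneg (by positivity),
    Real.rpow_add_one (norm_ne_zero_iff.2 hz), mul_assoc]

theorem enorm_A_coulomb_le (z : Vel d) : ‖A (-3) z‖ₑ ≤ truncPow z ^ 2 + 1 := by
  rw [← ofReal_norm]
  refine (ENNReal.ofReal_le_ofReal (norm_A_le _ z)).trans ?_
  rw [show (-3 + 2 : ℝ) = -1 by norm_num]
  exact ofReal_norm_rpow_neg_le z (by norm_num) (by norm_num)

theorem enorm_b_coulomb_le (z : Vel 3) : ‖b (-3) z‖ₑ ≤ 2 * (truncPow z ^ 3 + 1) := by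
  rw [← ofReal_norm]
  refine (ENNReal.ofReal_le_ofReal (norm_b_le _ z)).trans ?_
  rw [show (-3 + 1 : ℝ) = -2 by norm_num, show |((3 : ℕ) : ℝ) - 1| = 2 by norm_num,
    ENNReal.ofReal_mul zero_le_two, ENNReal.ofReal_ofNat]
  gcongr
  exact ofReal_norm_rpow_neg_le z (by norm_num) (by norm_num)

theorem stronglyMeasurable_A (γ : ℝ) : StronglyMeasurable (A (d := d) γ) := by
  have hcont : Continuous fun z : Vel d =>
      ‖z‖ ^ 2 • ContinuousLinearMap.id ℝ (Vel d) - (innerSL ℝ z).smulRight z := by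
    have : Continuous fun z : Vel d => (innerSL ℝ z).smulRight z :=
      (ContinuousLinearMap.smulRightL ℝ (Vel d) (Vel d)).continuous₂.comp
        ((innerSL ℝ (E := Vel d)).continuous.prodMk continuous_id)
    fun_prop
  exact (measurable_norm.pow_const γ).stronglyMeasurable.smul hcont.stronglyMeasurable

theorem stronglyMeasurable_b (γ : ℝ) : StronglyMeasurable (b (d := d) γ) :=
  ((measurable_norm.pow_const γ).const_mul _).stronglyMeasurable.smul stronglyMeasurable_id

end KernelBounds

section SingularConvolution

variable {G E : Type*} [AddCommGroup G] [MeasurableSpace G] [NormedAddCommGroup E]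
  [NormedSpace ℝ E] {μ : Measure G} {h : G → ℝ} {T : G → E} {k : G → ℝ≥0∞} {c : ℝ≥0∞}

theorem lintegral_enorm_lsmul_le (hh : AEMeasurable h μ) (hc : c ≠ ∞)
    (hT : ∀ z, ‖T z‖ₑ ≤ c * (k z + 1)) (v : G) :
    ∫⁻ w, ‖ContinuousLinearMap.lsmul ℝ ℝ (h w) (T (v - w))‖ₑ ∂μ ≤
      c * ((∫⁻ w, ‖h w‖ₑ * k (v - w) ∂μ) + ∫⁻ w, ‖h w‖ₑ ∂μ) := by
  rw [← lintegral_add_right' _ hh.enorm, ← lintegral_const_mul' _ _ hc]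
  refine lintegral_mono fun w => ?_
  rw [ContinuousLinearMap.lsmul_apply, enorm_smul]
  refine (mul_le_mul_right (hT (v - w)) _).trans_eq ?_
  ring

theorem enorm_convolution_sq_le (hh : AEMeasurable h μ) (hc : c ≠ ∞)
    (hT : ∀ z, ‖T z‖ₑ ≤ c * (k z + 1)) (v : G) :
    ‖(h ⋆[ContinuousLinearMap.lsmul ℝ ℝ, μ] T) v‖ₑ ^ 2 ≤
      2 * c ^ 2 * ((∫⁻ w, ‖h w‖ₑ * k (v - w) ∂μ) ^ 2 + (∫⁻ w, ‖h w‖ₑ ∂μ) ^ 2) := by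
  calc ‖(h ⋆[ContinuousLinearMap.lsmul ℝ ℝ, μ] T) v‖ₑ ^ 2
      ≤ (c * ((∫⁻ w, ‖h w‖ₑ * k (v - w) ∂μ) + ∫⁻ w, ‖h w‖ₑ ∂μ)) ^ 2 := by
        gcongr
        exact (enorm_integral_le_lintegral_enorm _).trans (lintegral_enorm_lsmul_le hh hc hT v)
    _ = c ^ 2 * ((∫⁻ w, ‖h w‖ₑ * k (v - w) ∂μ) + ∫⁻ w, ‖h w‖ₑ ∂μ) ^ 2 := mul_pow _ _ _
    _ ≤ c ^ 2 * (2 * ((∫⁻ w, ‖h w‖ₑ * k (v - w) ∂μ) ^ 2 + (∫⁻ w, ‖h w‖ₑ ∂μ) ^ 2)) := by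
        gcongr
        exact ennreal_add_sq_le _ _
    _ = _ := by ring

theorem convolutionExistsAt_of_enorm_le [MeasurableAdd₂ G] [MeasurableNeg G]
    [μ.IsAddLeftInvariant] [μ.IsNegInvariant] (hh : Integrable h μ) (h_top : MemLp h ∞ μ)
    (hTm : StronglyMeasurable T) (hc : c ≠ ∞) (hT : ∀ z, ‖T z‖ₑ ≤ c * (k z + 1))
    (hk : ∫⁻ z, k z ∂μ ≠ ∞) (v : G) :
    ConvolutionExistsAt h T v (ContinuousLinearMap.lsmul ℝ ℝ) μ := by
  refine ⟨hh.aestronglyMeasurable.smul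
    (hTm.comp_measurable (measurable_const.sub measurable_id)).aestronglyMeasurable,
    (lintegral_enorm_lsmul_le hh.aemeasurable hc hT v).trans_lt ?_⟩
  refine ENNReal.mul_lt_top hc.lt_top (ENNReal.add_lt_top.2 ⟨?_, hh.hasFiniteIntegral⟩)
  calc ∫⁻ w, ‖h w‖ₑ * k (v - w) ∂μ ≤ ∫⁻ w, eLpNorm h ∞ μ * k (v - w) ∂μ := by
        refine lintegral_mono_ae ?_
        filter_upwards [ae_le_eLpNormEssSup (f := h) (μ := μ)] with w hw
        rw [eLpNorm_exponent_top]
        gcongr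
    _ = eLpNorm h ∞ μ * ∫⁻ z, k z ∂μ := by
        rw [lintegral_const_mul' _ _ h_top.eLpNorm_ne_top, lintegral_sub_left_eq_self]
    _ < ∞ := ENNReal.mul_lt_top h_top.eLpNorm_lt_top hk.lt_top

end SingularConvolution

section RelativeEntropy

theorem sq_sub_div_add_le_two_mul_sq_sqrt_sub_sqrt {s t : ℝ} (hs : 0 ≤ s) (ht : 0 ≤ t) :
    (s - t) ^ 2 / (s + t) ≤ 2 * (√s - √t) ^ 2 := by
  refine div_le_of_le_mul₀ (add_nonneg hs ht) (by positivity) ?_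
  have hfactor : (s - t) ^ 2 = (√s - √t) ^ 2 * (√s + √t) ^ 2 := by
    rw [← mul_pow, mul_comm, ← sq_sub_sq, Real.sq_sqrt hs, Real.sq_sqrt ht]
  calc (s - t) ^ 2 = (√s - √t) ^ 2 * (√s + √t) ^ 2 := hfactor
    _ ≤ (√s - √t) ^ 2 * (2 * (√s ^ 2 + √t ^ 2)) := by gcongr; exact add_sq_le
    _ = 2 * (√s - √t) ^ 2 * (s + t) := by rw [Real.sq_sqrt hs, Real.sq_sqrt ht]; ring

theorem sq_sqrt_sub_sqrt_le {s t : ℝ} (hs : 0 ≤ s) (ht : 0 ≤ t) (hst : 0 < s → 0 < t) :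
    (√s - √t) ^ 2 ≤ s * Real.log (s / t) - s + t := by
  rcases hs.eq_or_lt with rfl | hs
  · simp [Real.sq_sqrt ht]
  have ht := hst hs
  have hlog : Real.log (s / t) = 2 * Real.log (√s / √t) := by
    rw [← Real.sqrt_div hs.le, Real.log_sqrt (by positivity)]
    ring
  have hsqrt : s * (√s / √t)⁻¹ = √s * √t := by
    rw [inv_div, mul_div_assoc', div_eq_iff (by positivity), mul_right_comm,
      Real.mul_self_sqrt hs.le]
  have hle := mul_le_mul_of_nonneg_left
    (Real.one_sub_inv_le_log_of_pos (x := √s / √t) (by positivity)) hs.le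
  rw [mul_sub, hsqrt] at hle
  rw [hlog, sub_sq, Real.sq_sqrt hs.le, Real.sq_sqrt ht.le]
  linarith

theorem sq_sub_div_add_le {s t : ℝ} (hs : 0 ≤ s) (ht : 0 ≤ t) (hst : 0 < s → 0 < t) :
    (s - t) ^ 2 / (s + t) ≤ 2 * (s * Real.log (s / t) - s + t) :=
  (sq_sub_div_add_le_two_mul_sq_sqrt_sub_sqrt hs ht).trans
    (by gcongr; exact sq_sqrt_sub_sqrt_le hs ht hst)

theorem enorm_sub_sq_eq {s t : ℝ} (hs : 0 ≤ s) (ht : 0 ≤ t) :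
    ‖s - t‖ₑ ^ 2 = ENNReal.ofReal ((s - t) ^ 2 / (s + t)) * ENNReal.ofReal (s + t) := by
  rw [← ENNReal.ofReal_mul (by positivity), ← ofReal_norm, ← ENNReal.ofReal_pow (norm_nonneg _),
    Real.norm_eq_abs, sq_abs]
  rcases (add_nonneg hs ht).eq_or_lt with hzero | hpos
  · obtain ⟨rfl, rfl⟩ := (add_eq_zero_iff_of_nonneg hs ht).1 hzero.symm
    simp
  · rw [div_mul_cancel₀ _ hpos.ne']

variable {α : Type*} [MeasurableSpace α] {μ : Measure α}

theorem sq_lintegral_le_of_sq_le_mul {f g h : α → ℝ≥0∞} (hg : AEMeasurable g μ)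
    (hh : AEMeasurable h μ) (hfgh : ∀ x, f x ^ 2 ≤ g x * h x) :
    (∫⁻ x, f x ∂μ) ^ 2 ≤ (∫⁻ x, g x ∂μ) * ∫⁻ x, h x ∂μ := by
  have sq_le_iff (a b c : ℝ≥0∞) :
      a ^ 2 ≤ b * c ↔ a ≤ b ^ (1 / 2 : ℝ) * c ^ (1 / 2 : ℝ) := by
    rw [← ENNReal.mul_rpow_of_nonneg _ _ (by norm_num), one_div,
      ENNReal.le_rpow_inv_iff two_pos, ENNReal.rpow_two]
  simp only [sq_le_iff] at hfgh ⊢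
  exact (lintegral_mono hfgh).trans
    (ENNReal.lintegral_mul_norm_pow_le hg hh (by norm_num) (by norm_num) (by norm_num))

variable {f g : α → ℝ}

theorem integral_mul_log_div_sub_add (hf : Integrable f μ) (hg : Integrable g μ)
    (hmass : ∫ x, f x ∂μ = ∫ x, g x ∂μ)
    (hlog : Integrable (fun x => f x * Real.log (f x / g x)) μ) :
    ∫ x, (f x * Real.log (f x / g x) - f x + g x) ∂μ =
      ∫ x, f x * Real.log (f x / g x) ∂μ := by
  rw [integral_add (by exact hlog.sub hf) hg, integral_sub hlog hf, hmass, sub_add_cancel]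

theorem integral_mul_log_div_nonneg (hf0 : ∀ x, 0 ≤ f x) (hg0 : ∀ x, 0 ≤ g x)
    (hpos : ∀ᵐ x ∂μ, 0 < f x → 0 < g x) (hf : Integrable f μ) (hg : Integrable g μ)
    (hmass : ∫ x, f x ∂μ = ∫ x, g x ∂μ)
    (hlog : Integrable (fun x => f x * Real.log (f x / g x)) μ) :
    0 ≤ ∫ x, f x * Real.log (f x / g x) ∂μ := by
  rw [← integral_mul_log_div_sub_add hf hg hmass hlog]
  refine integral_nonneg_of_ae ?_
  filter_upwards [hpos] with x hx
  exact (sq_nonneg _).trans (sq_sqrt_sub_sqrt_le (hf0 x) (hg0 x) hx)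

theorem lintegral_sq_sub_div_add_le (hf0 : ∀ x, 0 ≤ f x) (hg0 : ∀ x, 0 ≤ g x)
    (hpos : ∀ᵐ x ∂μ, 0 < f x → 0 < g x) (hf : Integrable f μ) (hg : Integrable g μ)
    (hmass : ∫ x, f x ∂μ = ∫ x, g x ∂μ)
    (hlog : Integrable (fun x => f x * Real.log (f x / g x)) μ) :
    ∫⁻ x, ENNReal.ofReal ((f x - g x) ^ 2 / (f x + g x)) ∂μ ≤
      ENNReal.ofReal (2 * ∫ x, f x * Real.log (f x / g x) ∂μ) := by
  have hle : ∀ᵐ x ∂μ, (f x - g x) ^ 2 / (f x + g x) ≤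
      2 * (f x * Real.log (f x / g x) - f x + g x) := by
    filter_upwards [hpos] with x hx
    exact sq_sub_div_add_le (hf0 x) (hg0 x) hx
  have hint : Integrable (fun x => 2 * (f x * Real.log (f x / g x) - f x + g x)) μ :=
    ((hlog.sub hf).add hg).const_mul 2
  rw [← integral_mul_log_div_sub_add hf hg hmass hlog, ← integral_const_mul,
    ofReal_integral_eq_lintegral_ofReal hint]
  · exact lintegral_mono_ae (hle.mono fun x hx => ENNReal.ofReal_le_ofReal hx)
  · exact hle.mono fun x hx =>
      (div_nonneg (sq_nonneg _) (add_nonneg (hf0 x) (hg0 x))).trans hx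

theorem eLpNorm_one_sub_sq_le (hf0 : ∀ x, 0 ≤ f x) (hg0 : ∀ x, 0 ≤ g x)
    (hpos : ∀ᵐ x ∂μ, 0 < f x → 0 < g x) (hf : Integrable f μ) (hg : Integrable g μ)
    (hmass : ∫ x, f x ∂μ = ∫ x, g x ∂μ)
    (hlog : Integrable (fun x => f x * Real.log (f x / g x)) μ) :
    eLpNorm (f - g) 1 μ ^ 2 ≤
      ENNReal.ofReal (4 * (∫ x, g x ∂μ) * ∫ x, f x * Real.log (f x / g x) ∂μ) := by
  have hK := integral_mul_log_div_nonneg hf0 hg0 hpos hf hg hmass hlog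
  have hfm := hf.aemeasurable
  have hgm := hg.aemeasurable
  rw [eLpNorm_one_eq_lintegral_enorm]
  calc (∫⁻ x, ‖(f - g) x‖ₑ ∂μ) ^ 2
      ≤ (∫⁻ x, ENNReal.ofReal ((f x - g x) ^ 2 / (f x + g x)) ∂μ) *
          ∫⁻ x, ENNReal.ofReal (f x + g x) ∂μ :=
        sq_lintegral_le_of_sq_le_mul (by fun_prop) (by fun_prop)
          fun x => (enorm_sub_sq_eq (hf0 x) (hg0 x)).le
    _ ≤ ENNReal.ofReal (2 * ∫ x, f x * Real.log (f x / g x) ∂μ) *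
          ENNReal.ofReal (∫ x, (f x + g x) ∂μ) := by
        rw [ofReal_integral_eq_lintegral_ofReal (hf.fun_add hg)
          (.of_forall fun x => add_nonneg (hf0 x) (hg0 x))]
        gcongr
        exact lintegral_sq_sub_div_add_le hf0 hg0 hpos hf hg hmass hlog
    _ = _ := by
        rw [integral_add hf hg, hmass, ← ENNReal.ofReal_mul (by positivity)]
        congr 1
        ring

theorem eLpNorm_two_sub_sq_le (hf0 : ∀ x, 0 ≤ f x) (hg0 : ∀ x, 0 ≤ g x)
    (hpos : ∀ᵐ x ∂μ, 0 < f x → 0 < g x) (hf : Integrable f μ) (hg : Integrable g μ)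
    (hmass : ∫ x, f x ∂μ = ∫ x, g x ∂μ)
    (hlog : Integrable (fun x => f x * Real.log (f x / g x)) μ)
    (hf_top : MemLp f ∞ μ) (hg_top : MemLp g ∞ μ) :
    eLpNorm (f - g) 2 μ ^ 2 ≤ ENNReal.ofReal
      (2 * (lpNorm f ∞ μ + lpNorm g ∞ μ) * ∫ x, f x * Real.log (f x / g x) ∂μ) := by
  have hK := integral_mul_log_div_nonneg hf0 hg0 hpos hf hg hmass hlog
  rw [eLpNorm_two_sq]
  calc ∫⁻ x, ‖(f - g) x‖ₑ ^ 2 ∂μ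
      ≤ ∫⁻ x, ENNReal.ofReal ((f x - g x) ^ 2 / (f x + g x)) *
          ENNReal.ofReal (lpNorm f ∞ μ + lpNorm g ∞ μ) ∂μ := by
        refine lintegral_mono_ae ?_
        filter_upwards [ae_le_lpNorm_exponent_top hf_top, ae_le_lpNorm_exponent_top hg_top]
          with x hfx hgx
        rw [Pi.sub_apply, enorm_sub_sq_eq (hf0 x) (hg0 x)]
        gcongr
        exacts [(Real.le_norm_self _).trans hfx, (Real.le_norm_self _).trans hgx]
    _ ≤ ENNReal.ofReal (2 * ∫ x, f x * Real.log (f x / g x) ∂μ) *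
          ENNReal.ofReal (lpNorm f ∞ μ + lpNorm g ∞ μ) := by
        rw [lintegral_mul_const' _ _ ENNReal.ofReal_ne_top]
        gcongr
        exact lintegral_sq_sub_div_add_le hf0 hg0 hpos hf hg hmass hlog
    _ = _ := by
        rw [← ENNReal.ofReal_mul (by positivity)]
        congr 1
        ring

end RelativeEntropy

section CoulombConvolution

theorem integrable_and_integral_le_of_lintegral_le {α : Type*} [MeasurableSpace α]
    {μ : Measure α} {φ : α → ℝ} {r : ℝ} (hφ : AEStronglyMeasurable φ μ) (hφ0 : ∀ x, 0 ≤ φ x)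
    (hr : 0 ≤ r) (hle : ∫⁻ x, ENNReal.ofReal (φ x) ∂μ ≤ ENNReal.ofReal r) :
    Integrable φ μ ∧ ∫ x, φ x ∂μ ≤ r := by
  refine ⟨⟨hφ, ?_⟩, ?_⟩
  · rw [hasFiniteIntegral_iff_ofReal (.of_forall hφ0)]
    exact hle.trans_lt ENNReal.ofReal_lt_top
  · rw [integral_eq_lintegral_of_nonneg_ae (.of_forall hφ0) hφ]
    exact ENNReal.toReal_le_of_le_ofReal hr hle

variable {d : ℕ}

theorem stronglyMeasurable_convA (γ : ℝ) {h : Vel d → ℝ} (hh : Measurable h) :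
    StronglyMeasurable (convA γ h) :=
  StronglyMeasurable.integral_prod_right <|
    (hh.comp measurable_snd).stronglyMeasurable.smul <|
      (stronglyMeasurable_A γ).comp_measurable (measurable_fst.sub measurable_snd)

theorem stronglyMeasurable_convB (γ : ℝ) {h : Vel d → ℝ} (hh : Measurable h) :
    StronglyMeasurable (convB γ h) :=
  StronglyMeasurable.integral_prod_right <|
    (hh.comp measurable_snd).stronglyMeasurable.smul <|
      (stronglyMeasurable_b γ).comp_measurable (measurable_fst.sub measurable_snd)

theorem convAExistsAt_coulomb {h : Vel 3 → ℝ} (hh : Integrable h) (h_top : MemLp h ∞)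
    (v : Vel 3) : ConvAExistsAt (-3) h v :=
  convolutionExistsAt_of_enorm_le hh h_top (stronglyMeasurable_A _) ENNReal.one_ne_top
    (by simpa using enorm_A_coulomb_le)
    (lintegral_truncPow_pow_lt_top volume two_ne_zero (by simp)).ne v

theorem convBExistsAt_coulomb {h : Vel 3 → ℝ} (hh : Integrable h) (h_top : MemLp h ∞)
    (v : Vel 3) : ConvBExistsAt (-3) h v :=
  convolutionExistsAt_of_enorm_le hh h_top (stronglyMeasurable_b _) ENNReal.ofNat_ne_top
    enorm_b_coulomb_le (lintegral_truncPow_pow_lt_top volume three_ne_zero (by simp)).ne v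

theorem enorm_convA_coulomb_sq_le {h : Vel d → ℝ} (hh : Measurable h) (v : Vel d) :
    ‖convA (-3) h v‖ₑ ^ 2 ≤
      2 * (eLpNorm h 2 ^ 2 * eLpNorm (truncPow : Vel d → ℝ≥0∞) 4 ^ 4 + eLpNorm h 1 ^ 2) := by
  have hconv := enorm_convolution_sq_le (μ := volume) (T := A (-3)) hh.aemeasurable
    ENNReal.one_ne_top (by simpa using enorm_A_coulomb_le) v
  rw [one_pow, mul_one] at hconv
  refine hconv.trans ?_
  rw [eLpNorm_one_eq_lintegral_enorm]
  gcongr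
  calc (∫⁻ w, ‖h w‖ₑ * truncPow (v - w) ^ 2) ^ 2
      ≤ (eLpNorm h 2 * eLpNorm (truncPow : Vel d → ℝ≥0∞) 4 ^ 2) ^ 2 := by
        rw [← eLpNorm_enorm h]
        gcongr
        exact lintegral_mul_comp_sub_left_sq_le hh.enorm measurable_truncPow v
    _ = _ := by ring

theorem lintegral_mul_enorm_convB_coulomb_sq_le {F h : Vel 3 → ℝ} (hF : Measurable F)
    (hh : Measurable h) :
    ∫⁻ v, ‖F v‖ₑ * ‖convB (-3) h v‖ₑ ^ 2 ≤
      8 * (eLpNorm (truncPow : Vel 3 → ℝ≥0∞) 4 ^ 6 * eLpNorm h 2 ^ 2 * eLpNorm F 2 +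
        eLpNorm h 1 ^ 2 * eLpNorm F 1) := by
  have hcube : Measurable fun v => ‖F v‖ₑ * (∫⁻ w, ‖h w‖ₑ * truncPow (v - w) ^ 3) ^ 2 :=
    hF.enorm.mul <| (Measurable.lintegral_prod_right <|
      (hh.comp measurable_snd).enorm.mul <|
        (measurable_truncPow.comp (measurable_fst.sub measurable_snd)).pow_const 3).pow_const 2
  calc ∫⁻ v, ‖F v‖ₑ * ‖convB (-3) h v‖ₑ ^ 2
      ≤ ∫⁻ v, ‖F v‖ₑ * (2 * 2 ^ 2 * ((∫⁻ w, ‖h w‖ₑ * truncPow (v - w) ^ 3) ^ 2 +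
          (∫⁻ w, ‖h w‖ₑ) ^ 2)) := by
        gcongr with v
        exact enorm_convolution_sq_le hh.aemeasurable ENNReal.ofNat_ne_top enorm_b_coulomb_le v
    _ = 8 * ((∫⁻ v, ‖F v‖ₑ * (∫⁻ w, ‖h w‖ₑ * truncPow (v - w) ^ 3) ^ 2) +
          (∫⁻ w, ‖h w‖ₑ) ^ 2 * ∫⁻ v, ‖F v‖ₑ) := by
        rw [← lintegral_const_mul _ hF.enorm, ← lintegral_add_left hcube,
          ← lintegral_const_mul' _ _ ENNReal.ofNat_ne_top]
        exact lintegral_congr fun v => by ring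
    _ ≤ _ := by
        rw [eLpNorm_one_eq_lintegral_enorm, eLpNorm_one_eq_lintegral_enorm, ← eLpNorm_enorm h,
          ← eLpNorm_enorm F]
        gcongr
        exact lintegral_mul_sq_lintegral_mul_comp_sub_cube_le hF.enorm hh.enorm
          measurable_truncPow

theorem exists_norm_convA_coulomb_sq_le :
    ∃ C : ℝ, 0 < C ∧ ∀ h : Vel 3 → ℝ, Measurable h → MemLp h 1 → MemLp h 2 → ∀ v,
      ‖convA (-3) h v‖ ^ 2 ≤ C * (lpNorm h 2 volume ^ 2 + lpNorm h 1 volume ^ 2) := by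
  have hκ := ENNReal.ofReal_toReal
    (eLpNorm_truncPow_four_lt_top (volume : Measure (Vel 3)) (by simp)).ne
  set κ := (eLpNorm (truncPow : Vel 3 → ℝ≥0∞) 4).toReal
  have hκ0 : 0 ≤ κ := ENNReal.toReal_nonneg
  refine ⟨2 * (κ ^ 4 + 1), by positivity, fun h hh h_one h_two v => ?_⟩
  have h1 : 0 ≤ lpNorm h 1 volume := lpNorm_nonneg
  have h2 : 0 ≤ lpNorm h 2 volume := lpNorm_nonneg
  have henorm := enorm_convA_coulomb_sq_le hh v
  have hbound : ENNReal.ofReal (2 * (lpNorm h 2 volume ^ 2 * κ ^ 4 + lpNorm h 1 volume ^ 2)) =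
      2 * (eLpNorm h 2 ^ 2 * eLpNorm (truncPow : Vel 3 → ℝ≥0∞) 4 ^ 4 + eLpNorm h 1 ^ 2) := by
    rw [ENNReal.ofReal_mul zero_le_two, ENNReal.ofReal_add (by positivity) (by positivity),
      ENNReal.ofReal_mul (by positivity), ENNReal.ofReal_pow h2, ENNReal.ofReal_pow hκ0,
      ENNReal.ofReal_pow h1, hκ, ofReal_lpNorm h_one, ofReal_lpNorm h_two, ENNReal.ofReal_ofNat]
  rw [← hbound, ← ofReal_norm, ← ENNReal.ofReal_pow (norm_nonneg _),
    ENNReal.ofReal_le_ofReal_iff (by positivity)] at henorm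
  refine henorm.trans ?_
  linarith [mul_nonneg (pow_nonneg hκ0 4) (sq_nonneg (lpNorm h 1 volume)),
    sq_nonneg (lpNorm h 2 volume)]

theorem exists_integral_mul_norm_convB_coulomb_sq_le :
    ∃ C : ℝ, 0 < C ∧ ∀ F h : Vel 3 → ℝ, Measurable F → (∀ v, 0 ≤ F v) → MemLp F 1 → MemLp F 2 →
      Measurable h → MemLp h 1 → MemLp h 2 →
      Integrable (fun v => F v * ‖convB (-3) h v‖ ^ 2) ∧
        ∫ v, F v * ‖convB (-3) h v‖ ^ 2 ≤
          C * (lpNorm h 2 volume ^ 2 * lpNorm F 2 volume +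
            lpNorm h 1 volume ^ 2 * lpNorm F 1 volume) := by
  have hκ := ENNReal.ofReal_toReal
    (eLpNorm_truncPow_four_lt_top (volume : Measure (Vel 3)) (by simp)).ne
  set κ := (eLpNorm (truncPow : Vel 3 → ℝ≥0∞) 4).toReal
  have hκ0 : 0 ≤ κ := ENNReal.toReal_nonneg
  refine ⟨8 * (κ ^ 6 + 1), by positivity, fun F h hF hF0 hF1 hF2 hh h_one h_two => ?_⟩
  have h1 : 0 ≤ lpNorm h 1 volume := lpNorm_nonneg
  have h2 : 0 ≤ lpNorm h 2 volume := lpNorm_nonneg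
  have hF1' : 0 ≤ lpNorm F 1 volume := lpNorm_nonneg
  have hF2' : 0 ≤ lpNorm F 2 volume := lpNorm_nonneg
  refine integrable_and_integral_le_of_lintegral_le
    (hF.aestronglyMeasurable.mul ((stronglyMeasurable_convB _ hh).norm.pow 2).aestronglyMeasurable)
    (fun v => mul_nonneg (hF0 v) (sq_nonneg _)) (by positivity) ?_
  have henorm (v : Vel 3) : ENNReal.ofReal (F v * ‖convB (-3) h v‖ ^ 2) =
      ‖F v‖ₑ * ‖convB (-3) h v‖ₑ ^ 2 := by
    rw [ENNReal.ofReal_mul (hF0 v), ENNReal.ofReal_pow (norm_nonneg _), ofReal_norm,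
      Real.enorm_of_nonneg (hF0 v)]
  simp only [henorm]
  refine (lintegral_mul_enorm_convB_coulomb_sq_le hF hh).trans ?_
  rw [← hκ, ← ofReal_lpNorm h_one, ← ofReal_lpNorm h_two, ← ofReal_lpNorm hF1,
    ← ofReal_lpNorm hF2, ← ENNReal.ofReal_pow hκ0, ← ENNReal.ofReal_pow h1,
    ← ENNReal.ofReal_pow h2, ← ENNReal.ofReal_mul (by positivity),
    ← ENNReal.ofReal_mul (by positivity), ← ENNReal.ofReal_mul (by positivity),
    ← ENNReal.ofReal_add (by positivity) (by positivity), ← ENNReal.ofReal_ofNat 8,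
    ← ENNReal.ofReal_mul (by positivity)]
  refine ENNReal.ofReal_le_ofReal ?_
  have hcross₁ : 0 ≤ κ ^ 6 * (lpNorm h 1 volume ^ 2 * lpNorm F 1 volume) := by positivity
  have hcross₂ : 0 ≤ lpNorm h 2 volume ^ 2 * lpNorm F 2 volume := by positivity
  linarith

end CoulombConvolution

section CoulombErrors

theorem memLp_and_lpNorm_sq_le {α E : Type*} [MeasurableSpace α] [NormedAddCommGroup E]
    {μ : Measure α} {p : ℝ≥0∞} {h : α → E} {r : ℝ} (hh : AEStronglyMeasurable h μ) (hr : 0 ≤ r)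
    (hle : eLpNorm h p μ ^ 2 ≤ ENNReal.ofReal r) : MemLp h p μ ∧ lpNorm h p μ ^ 2 ≤ r := by
  refine ⟨⟨hh, (ENNReal.pow_lt_top_iff.1 (hle.trans_lt ENNReal.ofReal_lt_top)).resolve_right
    two_ne_zero⟩, ?_⟩
  rw [← toReal_eLpNorm hh, ← ENNReal.toReal_pow]
  exact ENNReal.toReal_le_of_le_ofReal hr hle

theorem exists_one_le_mul_lpNorm_top (d : ℕ) (E : ℝ) :
    ∃ m : ℝ, 0 < m ∧ ∀ g : Vel d → ℝ, IsDensity g → energy g ≤ E → MemLp g ∞ →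
      1 ≤ m * lpNorm g ∞ volume := by
  obtain ⟨R, _, hball⟩ := exists_le_setIntegral_ball d E (ε := 1 / 2) (by norm_num)
  set B := volume.real (Metric.ball (0 : Vel d) R)
  refine ⟨2 * (B + 1), by positivity, fun g hg hE hg_top => ?_⟩
  have hsup : ∫ w in Metric.ball 0 R, g w ≤ B * lpNorm g ∞ volume := by
    rw [← smul_eq_mul, ← setIntegral_const]
    refine integral_mono_ae hg.integrable.integrableOn
      (integrableOn_const measure_ball_lt_top.ne) (ae_restrict_of_ae ?_)
    filter_upwards [ae_le_lpNorm_exponent_top hg_top] with w hw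
    exact (Real.le_norm_self _).trans hw
  linarith [hball g hg hE, lpNorm_nonneg (f := g) (p := ∞) (μ := volume)]

variable {d : ℕ} {f g : Vel d → ℝ}

theorem lpNorm_sub_sq_le_KL (hf0 : ∀ v, 0 ≤ f v) (hf1 : ∫ v, f v = 1) (hg : IsDensity g)
    (hpos : ∀ᵐ v, 0 < f v → 0 < g v) (hlog : Integrable fun v => f v * Real.log (f v / g v))
    (hf_top : MemLp f ∞) (hg_top : MemLp g ∞) :
    0 ≤ KL f g ∧
      (MemLp (f - g) 1 ∧ lpNorm (f - g) 1 volume ^ 2 ≤ 4 * KL f g) ∧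
      (MemLp (f - g) 2 ∧ lpNorm (f - g) 2 volume ^ 2 ≤
        2 * (lpNorm f ∞ volume + lpNorm g ∞ volume) * KL f g) := by
  have hf := integrable_of_integral_eq_one hf1
  have hmass : ∫ v, f v = ∫ v, g v := hf1.trans hg.integral_eq_one.symm
  have hsub := (hf.sub hg.integrable).aestronglyMeasurable
  have hK : 0 ≤ KL f g :=
    integral_mul_log_div_nonneg hf0 hg.nonneg hpos hf hg.integrable hmass hlog
  have hM : 0 ≤ lpNorm f ∞ volume + lpNorm g ∞ volume := add_nonneg lpNorm_nonneg lpNorm_nonneg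
  have h_one := eLpNorm_one_sub_sq_le hf0 hg.nonneg hpos hf hg.integrable hmass hlog
  rw [hg.integral_eq_one, mul_one] at h_one
  exact ⟨hK, memLp_and_lpNorm_sq_le hsub (by positivity) h_one,
    memLp_and_lpNorm_sq_le hsub (by positivity)
      (eLpNorm_two_sub_sq_le hf0 hg.nonneg hpos hf hg.integrable hmass hlog hf_top hg_top)⟩

theorem jb_rpow_neg_neg_three (v : Vel d) : jb v ^ (-(-3 : ℝ)) = jb v ^ 3 := by
  rw [neg_neg, ← Nat.cast_ofNat, Real.rpow_natCast]

theorem measurable_jb : Measurable (jb (d := d)) := by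
  unfold jb
  fun_prop

theorem exists_norm_convA_coulomb_sub_sq_le (E : ℝ) :
    ∃ C : ℝ, 0 < C ∧ ∀ f g : Vel 3 → ℝ, (∀ v, 0 ≤ f v) → Measurable f → ∫ v, f v = 1 →
      IsDensity g → energy g ≤ E → (∀ᵐ v, 0 < f v → 0 < g v) →
      (Integrable fun v => f v * Real.log (f v / g v)) → MemLp f ∞ → MemLp g ∞ → ∀ v,
      ‖convA (-3) (f - g) v‖ ^ 2 ≤
        C * KL f g * (lpNorm f ∞ volume + lpNorm g ∞ volume) := by
  obtain ⟨C, hC, hconv⟩ := exists_norm_convA_coulomb_sq_le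
  obtain ⟨m, hm, hsup⟩ := exists_one_le_mul_lpNorm_top 3 E
  refine ⟨C * (2 + 4 * m), by positivity,
    fun f g hf0 hfm hf1 hg hE hpos hlog hf_top hg_top v => ?_⟩
  obtain ⟨hK, ⟨h_one, h_one_le⟩, h_two, h_two_le⟩ :=
    lpNorm_sub_sq_le_KL hf0 hf1 hg hpos hlog hf_top hg_top
  set K := KL f g
  set M := lpNorm f ∞ volume + lpNorm g ∞ volume
  have hmM : 1 ≤ m * M :=
    (hsup g hg hE hg_top).trans (by gcongr; exact le_add_of_nonneg_left lpNorm_nonneg)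
  calc ‖convA (-3) (f - g) v‖ ^ 2
      ≤ C * (lpNorm (f - g) 2 volume ^ 2 + lpNorm (f - g) 1 volume ^ 2) :=
        hconv _ (hfm.sub hg.differentiable.continuous.measurable) h_one h_two v
    _ ≤ C * (2 * M * K + 4 * (K * (m * M))) := by
        gcongr
        exact h_one_le.trans (by gcongr; exact le_mul_of_one_le_right hK hmM)
    _ = C * (2 + 4 * m) * K * M := by ring

theorem exists_integral_diffusionErrorIntegrand_coulomb_le (E : ℝ) :
    ∃ C : ℝ, 0 < C ∧ ∀ f g : Vel 3 → ℝ, (∀ v, 0 ≤ f v) → Measurable f → ∫ v, f v = 1 →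
      IsDensity g → energy g ≤ E → (∀ᵐ v, 0 < f v → 0 < g v) → CoulombRhsFinite f g →
      Integrable (diffusionErrorIntegrand (-3) f g) ∧
        ∫ v, diffusionErrorIntegrand (-3) f g v ≤
          C * KL f g * ((lpNorm f ∞ volume + lpNorm g ∞ volume) *
            lpNorm (fun v => f v * jb v ^ 3 * ‖score f v‖ ^ 2) 1 volume) := by
  obtain ⟨C, hC, hconv⟩ := exists_norm_convA_coulomb_sub_sq_le E
  refine ⟨C, hC, fun f g hf0 hfm hf1 hg hE hpos hR => ?_⟩
  set B := C * KL f g * (lpNorm f ∞ volume + lpNorm g ∞ volume)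
  set F : Vel 3 → ℝ := fun v => f v * jb v ^ 3 * ‖score f v‖ ^ 2
  have hF0 (v : Vel 3) : 0 ≤ F v :=
    mul_nonneg (mul_nonneg (hf0 v) (pow_nonneg (jb_pos v).le 3)) (sq_nonneg _)
  have hF : Integrable F := memLp_one_iff_integrable.1 hR.fisher
  have heq : diffusionErrorIntegrand (-3) f g = fun v => ‖convA (-3) (f - g) v‖ ^ 2 * F v := by
    ext v
    rw [diffusionErrorIntegrand, jb_rpow_neg_neg_three, mul_right_comm, mul_comm]
  have hle (v : Vel 3) : diffusionErrorIntegrand (-3) f g v ≤ B * F v := by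
    rw [heq]
    exact mul_le_mul_of_nonneg_right
      (hconv f g hf0 hfm hf1 hg hE hpos hR.kl hR.sup_left hR.sup_right v) (hF0 v)
  have hsubm : Measurable (f - g) := hfm.sub hg.differentiable.continuous.measurable
  have hmeas : AEStronglyMeasurable (diffusionErrorIntegrand (-3) f g) := by
    rw [heq]
    exact ((stronglyMeasurable_convA _ hsubm).norm.pow 2).aestronglyMeasurable.mul
      hF.aestronglyMeasurable
  have hint : Integrable (diffusionErrorIntegrand (-3) f g) :=
    (hF.const_mul B).mono' hmeas (.of_forall fun v => by
      rw [Real.norm_of_nonneg (diffusionErrorIntegrand_nonneg hf0 g v)]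
      exact hle v)
  refine ⟨hint, (integral_mono hint (hF.const_mul B) hle).trans_eq ?_⟩
  rw [integral_const_mul, lpNorm_one_eq_integral_norm hF.aestronglyMeasurable, ← mul_assoc]
  simp only [Real.norm_of_nonneg (hF0 _), B]

theorem exists_integral_driftErrorIntegrand_coulomb_le :
    ∃ C : ℝ, 0 < C ∧ ∀ f g : Vel 3 → ℝ, (∀ v, 0 ≤ f v) → Measurable f → ∫ v, f v = 1 →
      IsDensity g → (∀ᵐ v, 0 < f v → 0 < g v) → CoulombRhsFinite f g →
      Integrable (driftErrorIntegrand (-3) f g) ∧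
        ∫ v, driftErrorIntegrand (-3) f g v ≤
          C * KL f g * ((lpNorm f ∞ volume + lpNorm g ∞ volume) *
            lpNorm (fun v => f v * jb v ^ 3) 2 volume +
            lpNorm (fun v => f v * jb v ^ 3) 1 volume) := by
  obtain ⟨C, hC, hconv⟩ := exists_integral_mul_norm_convB_coulomb_sq_le
  refine ⟨4 * C, by positivity, fun f g hf0 hfm hf1 hg hpos hR => ?_⟩
  obtain ⟨hK, ⟨h_one, h_one_le⟩, h_two, h_two_le⟩ :=
    lpNorm_sub_sq_le_KL hf0 hf1 hg hpos hR.kl hR.sup_left hR.sup_right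
  set F : Vel 3 → ℝ := fun v => f v * jb v ^ 3
  have heq : driftErrorIntegrand (-3) f g = fun v => F v * ‖convB (-3) (f - g) v‖ ^ 2 := by
    ext v
    rw [driftErrorIntegrand, jb_rpow_neg_neg_three]
  obtain ⟨hint, hle⟩ := hconv F (f - g) (hfm.mul (measurable_jb.pow_const 3))
    (fun v => mul_nonneg (hf0 v) (pow_nonneg (jb_pos v).le 3)) hR.weighted_one hR.weighted_two
    (hfm.sub hg.differentiable.continuous.measurable) h_one h_two
  rw [heq]
  refine ⟨hint, hle.trans ?_⟩
  set K := KL f g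
  set M := lpNorm f ∞ volume + lpNorm g ∞ volume
  have hM : 0 ≤ M := add_nonneg lpNorm_nonneg lpNorm_nonneg
  have hF2 : 0 ≤ lpNorm F 2 volume := lpNorm_nonneg
  calc C * (lpNorm (f - g) 2 volume ^ 2 * lpNorm F 2 volume +
        lpNorm (f - g) 1 volume ^ 2 * lpNorm F 1 volume)
      ≤ C * (2 * M * K * lpNorm F 2 volume + 4 * K * lpNorm F 1 volume) := by
        gcongr
        exact lpNorm_nonneg
    _ ≤ C * (4 * M * K * lpNorm F 2 volume + 4 * K * lpNorm F 1 volume) := by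
        gcongr
        norm_num
    _ = 4 * C * K * (M * lpNorm F 2 volume + lpNorm F 1 volume) := by ring

theorem exists_rhsFinite_coulomb_and_error_le (E : ℝ) :
    ∃ C : ℝ, 0 < C ∧ ∀ f g : Vel 3 → ℝ, (∀ v, 0 ≤ f v) → Measurable f → ∫ v, f v = 1 →
      IsDensity g → energy g ≤ E → (∀ᵐ v, 0 < f v → 0 < g v) → CoulombRhsFinite f g →
      RhsFinite (-3) f g ∧
        (∫ v, diffusionErrorIntegrand (-3) f g v) + (∫ v, driftErrorIntegrand (-3) f g v) ≤
          C * KL f g * coulombFactor f g := by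
  obtain ⟨C₁, hC₁, hdiffusion⟩ := exists_integral_diffusionErrorIntegrand_coulomb_le E
  obtain ⟨C₂, hC₂, hdrift⟩ := exists_integral_driftErrorIntegrand_coulomb_le
  refine ⟨C₁ + C₂, by positivity, fun f g hf0 hf hf1 hg hE hpos hR => ?_⟩
  have hsub := (integrable_of_integral_eq_one hf1).sub hg.integrable
  have hsub_top := hR.sup_left.sub hR.sup_right
  obtain ⟨hdiffusion_int, hdiffusion_le⟩ := hdiffusion f g hf0 hf hf1 hg hE hpos hR
  obtain ⟨hdrift_int, hdrift_le⟩ := hdrift f g hf0 hf hf1 hg hpos hR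
  refine ⟨⟨.of_forall fun v _ => convAExistsAt_coulomb hg.integrable hR.sup_right v,
    .of_forall fun v _ => convAExistsAt_coulomb hsub hsub_top v,
    .of_forall fun v _ => convBExistsAt_coulomb hsub hsub_top v,
    hR.dissipation, hdiffusion_int, hdrift_int⟩, ?_⟩
  have hK := (lpNorm_sub_sq_le_KL hf0 hf1 hg hpos hR.kl hR.sup_left hR.sup_right).1
  have hM : 0 ≤ lpNorm f ∞ volume + lpNorm g ∞ volume := add_nonneg lpNorm_nonneg lpNorm_nonneg
  rw [coulombFactor, mul_add (lpNorm f ∞ volume + _), add_assoc (_ * _), mul_add]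
  gcongr
  · exact hdiffusion_le.trans (by
      gcongr
      · exact mul_nonneg hM lpNorm_nonneg
      · exact le_add_of_nonneg_right hC₂.le)
  · exact hdrift_le.trans (by
      gcongr
      · exact add_nonneg (mul_nonneg hM lpNorm_nonneg) lpNorm_nonneg
      · exact le_add_of_nonneg_left hC₁.le)

theorem exists_integral_lhsIntegrand_coulomb_le (E H : ℝ) :
    ∃ C : ℝ, 0 < C ∧ ∀ f g : Vel 3 → ℝ, (∀ v, 0 ≤ f v) → Differentiable ℝ f → ∫ v, f v = 1 →
      IsDensity g → energy g ≤ E → entropy g ≤ H → LhsFinite (-3) f g → CoulombRhsFinite f g →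
      (∫ v, lhsIntegrand (-3) f g v) ≤
        -(1 / 2) * (∫ v, dissipationIntegrand (-3) f g v) + C * KL f g * coulombFactor f g := by
  obtain ⟨C₁, hC₁, hbound⟩ := exists_integral_lhsIntegrand_le 3 (-3) E H
  obtain ⟨C₂, hC₂, herror⟩ := exists_rhsFinite_coulomb_and_error_le E
  refine ⟨C₁ * C₂, by positivity, fun f g hf0 hf hf1 hg hE hH hL hR => ?_⟩
  obtain ⟨hfinite, herror_le⟩ := herror f g hf0 hf.continuous.measurable hf1 hg hE hL.pos hR
  refine (hbound f g hf0 hf hg hE hH hL hfinite).trans ?_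
  rw [add_assoc, ← mul_add, mul_assoc C₁, mul_assoc C₁]
  gcongr

end CoulombErrors

end Landau

open Landau in
theorem mainTheorem3_general :
    (∀ (d : ℕ) (γ E H : ℝ), ∃ C : ℝ, 0 < C ∧
      ∀ f g : Vel d → ℝ, (∀ v, 0 ≤ f v) → Differentiable ℝ f → IsDensity g →
        energy g ≤ E → entropy g ≤ H → LhsFinite γ f g → RhsFinite γ f g →
        (∫ v, lhsIntegrand γ f g v) ≤
          -(1 / 2) * (∫ v, dissipationIntegrand γ f g v)
            + C * (∫ v, diffusionErrorIntegrand γ f g v)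
            + C * (∫ v, driftErrorIntegrand γ f g v)) ∧
    (∀ E H : ℝ, ∃ C : ℝ, 0 < C ∧
      ∀ f g : Vel 3 → ℝ, (∀ v, 0 ≤ f v) → Differentiable ℝ f → ∫ v, f v = 1 → IsDensity g →
        energy g ≤ E → entropy g ≤ H → LhsFinite (-3) f g → CoulombRhsFinite f g →
        (∫ v, lhsIntegrand (-3) f g v) ≤
          -(1 / 2) * (∫ v, dissipationIntegrand (-3) f g v)
            + C * KL f g * coulombFactor f g) :=
  ⟨exists_integral_lhsIntegrand_le, exists_integral_lhsIntegrand_coulomb_le⟩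

open Landau in
theorem mainTheorem3 :
    (∀ (d : ℕ) (γ : ℝ), γ ≤ 0 → ∀ E H : ℝ, ∃ C : ℝ, 0 < C ∧
      ∀ f g : Vel d → ℝ, IsDensity f → IsDensity g → energy g ≤ E → entropy g ≤ H →
        LhsFinite γ f g → RhsFinite γ f g →
        (∫ v, lhsIntegrand γ f g v) ≤
          -(1 / 2) * (∫ v, dissipationIntegrand γ f g v)
            + C * (∫ v, diffusionErrorIntegrand γ f g v)
            + C * (∫ v, driftErrorIntegrand γ f g v)) ∧
    (∀ E H : ℝ, ∃ C : ℝ, 0 < C ∧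
      ∀ f g : Vel 3 → ℝ, IsDensity f → IsDensity g → energy g ≤ E → entropy g ≤ H →
        LhsFinite (-3) f g → CoulombRhsFinite f g →
        (∫ v, lhsIntegrand (-3) f g v) ≤
          -(1 / 2) * (∫ v, dissipationIntegrand (-3) f g v)
            + C * KL f g * coulombFactor f g) :=
  ⟨fun d γ _ E H => (mainTheorem3_general.1 d γ E H).imp fun _ h =>
      ⟨h.1, fun f g hf => h.2 f g hf.nonneg hf.differentiable⟩,
    fun E H => (mainTheorem3_general.2 E H).imp fun _ h =>
      ⟨h.1, fun f g hf => h.2 f g hf.nonneg hf.differentiable hf.integral_eq_one⟩⟩
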